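/- All graphs are finite and simple, $\log$ denotes the logarithm to base $2$, and an $r$-regular subgraph of a graph is a (not necessarily induced or spanning) subgraph with non-empty vertex set in which every vertex has degree exactly $r$. (i) There is an absolute constant $C>0$ such that for all positive integers $r,n$ with $r\le n/2$, every $n$-vertex graph with average degree at least $C\,r\log(n/r)$ contains an $r$-regular subgraph. (ii) This bound is tight up to the value of the constant when $r\ge\frac12\log n$ (in particular when $r\ge\log n$): there is an absolute constant $c>0$ such that for all integers $r\ge 2$ and $n$ with $\frac12\log n\le r\le n/2$, there exists an $n$-vertex graph with average degree at least $c\,r\log(n/r)$ which contains no $r$-regular subgraph. -/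

import Mathlib

/-- The average degree of a graph on a finite vertex set. -/
noncomputable def SimpleGraph.avgDegree {V : Type*} [Fintype V] (G : SimpleGraph V) : ℝ :=
  open scoped Classical in (∑ v : V, (G.degree v : ℝ)) / (Fintype.card V : ℝ)

/-- `G` contains an `r`-regular subgraph: a subgraph (not necessarily induced or spanning) with
non-empty vertex set, in which every vertex has degree exactly `r`. -/
def SimpleGraph.HasRegularSubgraph {V : Type*} (G : SimpleGraph V) (r : ℕ) : Prop :=
  ∃ (H : G.Subgraph) (_ : H.coe.LocallyFinite), H.verts.Nonempty ∧ H.coe.IsRegularOfDegree r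

/-! Part (i). Pass to a bipartite subgraph keeping half the edges, of average degree d, and sort its
edges into dyadic levels by the larger end degree in it. Levels below about d carry at most a
quarter of the degree sum, and since d is at least a large multiple of r, only O(log(n/r)) levels
remain. Deleting edges at low-degree vertices within a level leaves, for some level, a non-empty
graph with degrees at most L and deg u · deg v ≥ DL on every edge, where D = Kr
(`exists_mul_le_degree_mul_degree`).

Keep each vertex v with probability deg v / L and each edge uv with probability DL/(deg u · deg v):
a kept vertex then has expected degree exactly D. Further sampling rounds shrink the window in which
almost all degrees lie. Each round keeps almost everything, so the fluctuations scale with the root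
of the window and not of the degree, and the window can be divided by 16 until it is constant
(`NearlyRegular.exists_step`). The result has maximum degree at most L' and average degree at least
L' - c, with c absolute and L' ≥ D/2 (`exists_almost_regular`).

By König's theorem this bipartite graph splits into about L' matchings. For a prime p in (r, 2r],
the largest 2p - 1 of them form a graph with degrees at most 2p - 1 and average above 2p - 2,
because L' is large compared with pc. Chevalley–Warning gives a p-regular subgraph
(`exists_degree_eq_prime`), and r of its p matchings give an r-regular one.

Part (ii). If n < 16r, a complete bipartite graph with a side of size r - 1 suffices. Otherwise join
each b in [r, n/2) to each vertex of [n/2, n) independently with probability εr/b; the harmonic sum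
yields order εnr·log(n/r) edges. In an r-regular subgraph with sides A and B, |A| = |B|, and at
least half of the b in B satisfy b ≥ |A|/2. Such a b has r neighbours in A with probability at most
(8ε)^r ≤ n^(-10), as n ≤ 4^r, and a union bound over A and B finishes. -/

open scoped Classical
open Finset

/-! ### Product measures on the subsets of a finite set. -/

section RandomSubset

variable {ι : Type*} [Fintype ι]

/-- The probability of `ω` when every `i` is put into a random subset independently with
probability `p i`. -/
noncomputable def subsetWeight (p : ι → ℝ) (ω : Finset ι) : ℝ :=
  ∏ i, if i ∈ ω then p i else 1 - p i

/-- The expectation of `f` at the random subset with inclusion probabilities `p`. -/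
noncomputable def subsetExpect (p : ι → ℝ) (f : Finset ι → ℝ) : ℝ :=
  ∑ ω : Finset ι, subsetWeight p ω * f ω

lemma subsetWeight_nonneg {p : ι → ℝ} (h0 : ∀ i, 0 ≤ p i) (h1 : ∀ i, p i ≤ 1) (ω : Finset ι) :
    0 ≤ subsetWeight p ω := by
  refine prod_nonneg fun i _ => ?_
  split_ifs
  · exact h0 i
  · linarith [h1 i]

/-- Independence of the coordinates, which amounts to expanding a product of two-term sums. -/
lemma subsetExpect_prod (p a b : ι → ℝ) :
    subsetExpect p (fun ω => ∏ i, if i ∈ ω then a i else b i) =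
      ∏ i, (p i * a i + (1 - p i) * b i) := by
  rw [Finset.prod_add, subsetExpect, Finset.powerset_univ]
  refine sum_congr rfl fun ω _ => ?_
  rw [subsetWeight, ← prod_mul_distrib, ← Finset.prod_mul_prod_compl ω, Finset.compl_eq_univ_sdiff]
  congr 1
  · exact prod_congr rfl fun i hi => by simp [hi]
  · exact prod_congr rfl fun i hi => by
      have : i ∉ ω := by simpa using hi
      simp [this]

lemma subsetExpect_subset (p : ι → ℝ) (K : Finset ι) :
    subsetExpect p (fun ω => if K ⊆ ω then 1 else 0) = ∏ i ∈ K, p i := by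
  have h := subsetExpect_prod p (fun _ => 1) (fun i => if i ∈ K then 0 else 1)
  have h1 : (fun ω : Finset ι => if K ⊆ ω then (1 : ℝ) else 0) =
      fun ω => ∏ i, if i ∈ ω then (1 : ℝ) else if i ∈ K then 0 else 1 := by
    funext ω
    split_ifs with hK
    · refine (prod_eq_one fun i _ => ?_).symm
      by_cases hi : i ∈ ω
      · simp [hi]
      · have : i ∉ K := fun h => hi (hK h)
        simp [this]
    · obtain ⟨i, hiK, hi⟩ := Finset.not_subset.1 hK
      exact (prod_eq_zero (mem_univ i) (by simp [hiK, hi])).symm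
  rw [h1, h, ← prod_filter_mul_prod_filter_not univ (· ∈ K)]
  rw [prod_congr rfl (g := p) (by intro i hi; simp_all), filter_mem_eq_inter, univ_inter]
  rw [prod_eq_one (s := univ.filter (¬ · ∈ K)) (by intro i hi; simp_all), mul_one]

lemma subsetExpect_const (p : ι → ℝ) (c : ℝ) : subsetExpect p (fun _ => c) = c := by
  have h := subsetExpect_subset p ∅
  simp only [subsetExpect, empty_subset, if_true, mul_one, prod_empty] at h ⊢
  rw [← sum_mul, h, one_mul]

lemma subsetExpect_add (p : ι → ℝ) (f g : Finset ι → ℝ) :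
    subsetExpect p (fun ω => f ω + g ω) = subsetExpect p f + subsetExpect p g := by
  simp [subsetExpect, mul_add, sum_add_distrib]

lemma subsetExpect_sub (p : ι → ℝ) (f g : Finset ι → ℝ) :
    subsetExpect p (fun ω => f ω - g ω) = subsetExpect p f - subsetExpect p g := by
  simp [subsetExpect, mul_sub, sum_sub_distrib]

lemma subsetExpect_mul_left (p : ι → ℝ) (c : ℝ) (f : Finset ι → ℝ) :
    subsetExpect p (fun ω => c * f ω) = c * subsetExpect p f := by
  simp only [subsetExpect, mul_sum]
  exact sum_congr rfl fun ω _ => by ring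

lemma subsetExpect_sum {α : Type*} (p : ι → ℝ) (s : Finset α) (f : α → Finset ι → ℝ) :
    subsetExpect p (fun ω => ∑ a ∈ s, f a ω) = ∑ a ∈ s, subsetExpect p (f a) := by
  simp only [subsetExpect, mul_sum]
  exact sum_comm

lemma subsetExpect_mono {p : ι → ℝ} (h0 : ∀ i, 0 ≤ p i) (h1 : ∀ i, p i ≤ 1)
    {f g : Finset ι → ℝ} (h : ∀ ω, f ω ≤ g ω) : subsetExpect p f ≤ subsetExpect p g :=
  sum_le_sum fun ω _ => mul_le_mul_of_nonneg_left (h ω) (subsetWeight_nonneg h0 h1 ω)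

lemma exists_le_of_le_subsetExpect {p : ι → ℝ} (h0 : ∀ i, 0 ≤ p i) (h1 : ∀ i, p i ≤ 1)
    {f : Finset ι → ℝ} {c : ℝ} (h : c ≤ subsetExpect p f) : ∃ ω, c ≤ f ω := by
  by_contra! hc
  obtain ⟨ω₀, hω₀⟩ : ∃ ω, subsetWeight p ω ≠ 0 := by
    by_contra! h'
    have := subsetExpect_const p 1
    simp [subsetExpect, h'] at this
  have : subsetExpect p f < subsetExpect p (fun _ => c) := by
    refine sum_lt_sum (fun ω _ => mul_le_mul_of_nonneg_left (hc ω).le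
      (subsetWeight_nonneg h0 h1 ω)) ⟨ω₀, mem_univ _, ?_⟩
    exact mul_lt_mul_of_pos_left (hc ω₀)
      (lt_of_le_of_ne (subsetWeight_nonneg h0 h1 ω₀) hω₀.symm)
  rw [subsetExpect_const] at this
  linarith

end RandomSubset

/-! ### Sampling vertices and edges; moment generating function of a degree. -/

section RandomSubgraph

variable {V : Type*} [Fintype V]

lemma subsetExpect_vertex (p : V → ℝ) (w : Sym2 V → ℝ) (v : V) :
    subsetExpect (Sum.elim p w) (fun ω => if Sum.inl v ∈ ω then 1 else 0) = p v := by
  have := subsetExpect_subset (Sum.elim p w) {Sum.inl v}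
  simpa using this

/-- The neighbours of `v` involve disjoint pairs of coordinates (the vertex `u` and the edge `vu`),
so their contributions are independent. Expanding the product over subsets reduces this to inclusion
probabilities. -/
lemma subsetExpect_star (p : V → ℝ) (w : Sym2 V → ℝ) (v : V) (N : Finset V) (hv : v ∉ N)
    (c : ℝ) :
    subsetExpect (Sum.elim p w) (fun ω => (if Sum.inl v ∈ ω then 1 else 0) *
      ∏ u ∈ N, (1 + c * (if Sum.inl u ∈ ω ∧ Sum.inr s(v, u) ∈ ω then 1 else 0))) =
      p v * ∏ u ∈ N, (1 + c * (p u * w s(v, u))) := by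
  have key : ∀ T ∈ N.powerset, subsetExpect (Sum.elim p w)
      (fun ω => (if Sum.inl v ∈ ω then 1 else 0) *
        ∏ u ∈ T, (c * (if Sum.inl u ∈ ω ∧ Sum.inr s(v, u) ∈ ω then (1 : ℝ) else 0))) =
      p v * ∏ u ∈ T, (c * (p u * w s(v, u))) := by
    intro T hT
    have hT' : v ∉ T := fun h => hv (mem_powerset.1 hT h)
    have h1 := subsetExpect_subset (Sum.elim p w) ((insert v T).disjSum (T.image (fun u => s(v, u))))
    rw [prod_disjSum, prod_insert (by simpa using hT'), prod_image (by
      intro a _ b _ hab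
      rcases (by simpa using hab : a = b ∨ v = b ∧ a = v) with h | ⟨h, h'⟩
      exacts [h, h'.trans h])] at h1
    simp only [Sum.elim_inl, Sum.elim_inr] at h1
    rw [prod_mul_distrib, prod_mul_distrib, show p v * ((∏ _ ∈ T, c) * ((∏ u ∈ T, p u) *
      ∏ u ∈ T, w s(v, u))) = (∏ _ ∈ T, c) * ((p v * ∏ u ∈ T, p u) * ∏ u ∈ T, w s(v, u)) by ring,
      ← h1, ← subsetExpect_mul_left]
    congr 1
    funext ω
    rw [prod_mul_distrib]
    have h2 : (∏ u ∈ T, (if Sum.inl u ∈ ω ∧ Sum.inr s(v, u) ∈ ω then (1 : ℝ) else 0)) =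
        if (∀ u ∈ T, Sum.inl u ∈ ω ∧ Sum.inr s(v, u) ∈ ω) then 1 else 0 := by
      exact prod_ite_zero .. |>.trans (by simp)
    rw [h2]
    have h3 : ((insert v T).disjSum (T.image (fun u => s(v, u))) ⊆ ω) ↔
        (Sum.inl v ∈ ω ∧ ∀ u ∈ T, Sum.inl u ∈ ω ∧ Sum.inr s(v, u) ∈ ω) := by
      simp only [subset_iff, Sum.forall, inl_mem_disjSum, inr_mem_disjSum, mem_insert, mem_image]
      constructor
      · rintro ⟨h, h'⟩
        exact ⟨h v (Or.inl rfl), fun u hu => ⟨h u (Or.inr hu), h' _ ⟨u, hu, rfl⟩⟩⟩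
      · rintro ⟨h, h'⟩
        refine ⟨?_, ?_⟩
        · rintro a (rfl | ha)
          exacts [h, (h' a ha).1]
        · rintro _ ⟨u, hu, rfl⟩
          exact (h' u hu).2
    simp only [h3]
    split_ifs <;> simp_all
  simp only [Finset.prod_one_add, mul_sum]
  rw [subsetExpect_sum]
  exact sum_congr rfl key

/-- The subgraph of `G` on the vertices and edges picked by `ω`. -/
def SimpleGraph.sampled (G : SimpleGraph V) (ω : Finset (V ⊕ Sym2 V)) : SimpleGraph V where
  Adj u v := G.Adj u v ∧ Sum.inl u ∈ ω ∧ Sum.inl v ∈ ω ∧ Sum.inr s(u, v) ∈ ω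
  symm := ⟨fun u v ⟨h, h1, h2, h3⟩ => ⟨h.symm, h2, h1, by rwa [Sym2.eq_swap]⟩⟩
  loopless := ⟨fun v h => G.loopless.irrefl v h.1⟩

lemma SimpleGraph.sampled_le {V : Type*} (G : SimpleGraph V) (ω : Finset (V ⊕ Sym2 V)) : G.sampled ω ≤ G :=
  fun _ _ h => h.1

lemma SimpleGraph.sampled_degree (G : SimpleGraph V) {ω : Finset (V ⊕ Sym2 V)} {v : V}
    (hv : Sum.inl v ∈ ω) : ((G.sampled ω).degree v : ℝ) =
      ∑ u ∈ G.neighborFinset v, if Sum.inl u ∈ ω ∧ Sum.inr s(v, u) ∈ ω then (1 : ℝ) else 0 := by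
  rw [sum_boole, ← SimpleGraph.card_neighborFinset_eq_degree]
  congr 2
  ext u
  simp only [SimpleGraph.mem_neighborFinset, mem_filter]
  simp [SimpleGraph.sampled, hv]

/-- Uses exp x ≤ 1 + x + x² for |x| ≤ 1 at both values of the centred variable; the linear terms
cancel and the quadratic ones give the variance. -/
lemma exp_centered_bernoulli_le {q l : ℝ} (h0 : 0 ≤ q) (h1 : q ≤ 1) (hl : |l| ≤ 1) :
    Real.exp (-(l * q)) * (1 + (Real.exp l - 1) * q) ≤ Real.exp (l ^ 2 * (q * (1 - q))) := by
  have hb : ∀ x : ℝ, |x| ≤ 1 → Real.exp x ≤ 1 + x + x ^ 2 := fun x hx => by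
    have := (abs_le.1 (Real.abs_exp_sub_one_sub_id_le hx)).2
    linarith
  have e1 : Real.exp (-(l * q)) * (1 + (Real.exp l - 1) * q) =
      (1 - q) * Real.exp (-(l * q)) + q * Real.exp (l * (1 - q)) := by
    rw [show l * (1 - q) = -(l * q) + l by ring, Real.exp_add]; ring
  have h2 := hb (-(l * q)) (by
    rw [abs_neg, abs_mul, abs_of_nonneg h0]
    exact mul_le_one₀ hl h0 h1)
  have h3 := hb (l * (1 - q)) (by
    rw [abs_mul, abs_of_nonneg (sub_nonneg.2 h1)]
    exact mul_le_one₀ hl (by linarith) (by linarith))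
  have h4 := mul_le_mul_of_nonneg_left h2 (sub_nonneg.2 h1)
  have h5 := mul_le_mul_of_nonneg_left h3 h0
  have h6 := Real.add_one_le_exp (l ^ 2 * (q * (1 - q)))
  rw [e1]
  nlinarith

lemma SimpleGraph.expect_exp_sampled_degree_le (G : SimpleGraph V) {p : V → ℝ} {w : Sym2 V → ℝ}
    (hp0 : ∀ v, 0 ≤ p v) (hp1 : ∀ v, p v ≤ 1) (hw0 : ∀ e, 0 ≤ w e) (hw1 : ∀ e, w e ≤ 1) {l : ℝ}
    (hl : |l| ≤ 1) (v : V) :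
    subsetExpect (Sum.elim p w) (fun ω => (if Sum.inl v ∈ ω then 1 else 0) *
      Real.exp (l * (((G.sampled ω).degree v : ℝ) -
        ∑ u ∈ G.neighborFinset v, p u * w s(v, u)))) ≤
      p v * Real.exp (l ^ 2 *
        ∑ u ∈ G.neighborFinset v, p u * w s(v, u) * (1 - p u * w s(v, u))) := by
  set N := G.neighborFinset v
  have hq0 : ∀ u, 0 ≤ p u * w s(v, u) := fun u => mul_nonneg (hp0 _) (hw0 _)
  have hq1 : ∀ u, p u * w s(v, u) ≤ 1 := fun u => mul_le_one₀ (hp1 _) (hw0 _) (hw1 _)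
  have h1 : ∀ ω : Finset (V ⊕ Sym2 V), (if Sum.inl v ∈ ω then (1 : ℝ) else 0) *
      Real.exp (l * (((G.sampled ω).degree v : ℝ) - ∑ u ∈ N, p u * w s(v, u))) =
      Real.exp (-(l * ∑ u ∈ N, p u * w s(v, u))) * ((if Sum.inl v ∈ ω then 1 else 0) *
      ∏ u ∈ N, (1 + (Real.exp l - 1) *
        (if Sum.inl u ∈ ω ∧ Sum.inr s(v, u) ∈ ω then 1 else 0))) := by
    intro ω
    by_cases hv : Sum.inl v ∈ ω
    · rw [G.sampled_degree hv, if_pos hv, one_mul, one_mul, mul_sub, sub_eq_neg_add, Real.exp_add]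
      congr 1
      rw [mul_sum, Real.exp_sum]
      refine prod_congr rfl fun u _ => ?_
      split_ifs <;> simp
    · simp [hv]
  simp only [h1]
  rw [subsetExpect_mul_left, subsetExpect_star _ _ _ _ (by simp [N]), mul_left_comm]
  refine mul_le_mul_of_nonneg_left ?_ (hp0 v)
  rw [mul_sum, ← sum_neg_distrib, Real.exp_sum, ← prod_mul_distrib, mul_sum, Real.exp_sum]
  refine prod_le_prod (fun u _ => ?_) fun u _ => exp_centered_bernoulli_le (hq0 u) (hq1 u) hl
  refine mul_nonneg (Real.exp_pos _).le ?_
  have := Real.exp_pos l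
  nlinarith [hq0 u, hq1 u, mul_nonneg this.le (hq0 u)]

end RandomSubgraph

/-! ### Trimming the degrees by deleting edges. -/

section Trim

variable {V : Type*} [Fintype V]

lemma SimpleGraph.degree_mono {G H : SimpleGraph V} (h : G ≤ H) (v : V) :
    G.degree v ≤ H.degree v := by
  rw [← SimpleGraph.card_neighborFinset_eq_degree, ← SimpleGraph.card_neighborFinset_eq_degree]
  refine card_le_card fun u hu => ?_
  rw [SimpleGraph.mem_neighborFinset] at hu ⊢
  exact h hu

lemma SimpleGraph.degree_lt_of_le {G H : SimpleGraph V} (h : G ≤ H) {u v : V} (h1 : H.Adj u v)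
    (h2 : ¬ G.Adj u v) : G.degree u < H.degree u := by
  rw [← SimpleGraph.card_neighborFinset_eq_degree, ← SimpleGraph.card_neighborFinset_eq_degree]
  refine card_lt_card ⟨fun w hw => ?_, fun h' => h2 ?_⟩
  · rw [SimpleGraph.mem_neighborFinset] at hw ⊢
    exact h hw
  · have := h' ((SimpleGraph.mem_neighborFinset _ _ _).2 h1)
    rwa [SimpleGraph.mem_neighborFinset] at this

lemma SimpleGraph.exists_delete_edge (G : SimpleGraph V) {u v : V} (h : G.Adj u v) :
    ∃ H ≤ G, ¬ H.Adj u v ∧ ∑ x, H.degree x + 2 = ∑ x, G.degree x := by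
  obtain ⟨H, hH⟩ : ∃ H, H = G.deleteEdges {s(u, v)} := ⟨_, rfl⟩
  refine ⟨H, hH ▸ SimpleGraph.deleteEdges_le _, by simp [hH], ?_⟩
  rw [SimpleGraph.sum_degrees_eq_twice_card_edges, SimpleGraph.sum_degrees_eq_twice_card_edges]
  have h1 : H.edgeFinset = G.edgeFinset.erase s(u, v) := by
    ext e
    rw [SimpleGraph.mem_edgeFinset, hH, mem_erase, SimpleGraph.mem_edgeFinset]
    simp [SimpleGraph.edgeSet_deleteEdges, and_comm]
  have h2 : s(u, v) ∈ G.edgeFinset := by simpa using h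
  have h3 := card_erase_add_one h2
  rw [h1]
  omega

/-- The degrees can be brought down to at most `K` by deleting at most one edge for every unit of
excess. -/
lemma SimpleGraph.exists_le_degree_le (G : SimpleGraph V) (K : ℕ) :
    ∃ H ≤ G, (∀ v, H.degree v ≤ K) ∧
      ∑ v, G.degree v ≤ ∑ v, H.degree v + 2 * ∑ v, (G.degree v - K) := by
  induction hn : ∑ v, (G.degree v - K) using Nat.strong_induction_on generalizing G with
  | _ n ih =>
    by_cases hK : ∀ v, G.degree v ≤ K
    · exact ⟨G, le_rfl, hK, by omega⟩
    · push Not at hK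
      obtain ⟨v, hv⟩ := hK
      obtain ⟨u, hu⟩ := (G.degree_pos_iff_exists_adj v).1 (by omega)
      obtain ⟨G₁, hle, hnot, h3⟩ := G.exists_delete_edge hu
      have hlt := SimpleGraph.degree_lt_of_le hle hu hnot
      have hsum : ∑ x, (G₁.degree x - K) < ∑ x, (G.degree x - K) :=
        sum_lt_sum (fun x _ => Nat.sub_le_sub_right (SimpleGraph.degree_mono hle x) K)
          ⟨v, mem_univ _, by omega⟩
      obtain ⟨H, hH, h1, h2⟩ := ih _ (hn ▸ hsum) _ rfl
      exact ⟨H, hH.trans hle, h1, by omega⟩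

end Trim

/-! ### Degree concentration in a sampled subgraph. -/

section Sampling

variable {V : Type*} [Fintype V]

lemma max_sub_le_add_exp {y a b : ℝ} (hb : 0 ≤ b) {l : ℝ} (hl : 0 < l) :
    max (|y| - a) 0 ≤ b + 1 / l * ((Real.exp (l * y) + Real.exp (-l * y)) *
      Real.exp (-l * (a + b))) := by
  have hpos : 0 ≤ 1 / l * ((Real.exp (l * y) + Real.exp (-l * y)) *
      Real.exp (-l * (a + b))) := by positivity
  refine max_le ?_ (by linarith)
  have h1 : Real.exp (l * |y|) ≤ Real.exp (l * y) + Real.exp (-l * y) := by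
    rcases abs_cases y with ⟨h, _⟩ | ⟨h, _⟩ <;> rw [h]
    · linarith [Real.exp_pos (-l * y)]
    · rw [mul_neg, ← neg_mul]; linarith [Real.exp_pos (l * y)]
  have h2 : l * (|y| - a - b) ≤ Real.exp (l * |y|) * Real.exp (-l * (a + b)) := by
    rw [← Real.exp_add]
    have := Real.add_one_le_exp (l * |y| + -l * (a + b))
    linarith
  have h3 : |y| - a - b ≤ 1 / l * (Real.exp (l * |y|) * Real.exp (-l * (a + b))) := by
    rw [one_div, inv_mul_eq_div, le_div_iff₀ hl]; linarith
  have h4 : 1 / l * (Real.exp (l * |y|) * Real.exp (-l * (a + b))) ≤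
      1 / l * ((Real.exp (l * y) + Real.exp (-l * y)) * Real.exp (-l * (a + b))) := by gcongr
  linarith

/-- The expected deviation of the degree of a sampled vertex beyond `t / 64`. -/
lemma SimpleGraph.expect_excess_le (G : SimpleGraph V) {p : V → ℝ} {w : Sym2 V → ℝ}
    (hp0 : ∀ v, 0 ≤ p v) (hp1 : ∀ v, p v ≤ 1) (hw0 : ∀ e, 0 ≤ w e) (hw1 : ∀ e, w e ≤ 1)
    {t b : ℝ} (hb : 0 ≤ b) (v : V)
    (hvar : 0 < p v → ∑ u ∈ G.neighborFinset v, p u * w s(v, u) * (1 - p u * w s(v, u)) ≤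
      2 * t + b) :
    subsetExpect (Sum.elim p w) (fun ω => (if Sum.inl v ∈ ω then 1 else 0) *
      max (|((G.sampled ω).degree v : ℝ) - ∑ u ∈ G.neighborFinset v, p u * w s(v, u)| - t / 64) 0) ≤
      p v * (b / 256 + 512 * Real.exp (-t / 32768)) := by
  set μ := ∑ u ∈ G.neighborFinset v, p u * w s(v, u)
  set σ := ∑ u ∈ G.neighborFinset v, p u * w s(v, u) * (1 - p u * w s(v, u))
  have hq0 : ∀ i, 0 ≤ Sum.elim p w i := by rintro (i | i); exacts [hp0 i, hw0 i]
  have hq1 : ∀ i, Sum.elim p w i ≤ 1 := by rintro (i | i); exacts [hp1 i, hw1 i]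
  have hA := G.expect_exp_sampled_degree_le hp0 hp1 hw0 hw1 (l := 1 / 256)
    (by norm_num [abs_of_pos]) v
  have hB := G.expect_exp_sampled_degree_le hp0 hp1 hw0 hw1 (l := -(1 / 256))
    (by norm_num [abs_of_pos]) v
  have hmono := subsetExpect_mono hq0 hq1 (f := fun ω => (if Sum.inl v ∈ ω then 1 else 0) *
      max (|((G.sampled ω).degree v : ℝ) - μ| - t / 64) 0)
    (g := fun ω => b / 256 * (if Sum.inl v ∈ ω then 1 else 0) +
      256 * Real.exp (-(1 / 256) * (t / 64 + b / 256)) *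
      ((if Sum.inl v ∈ ω then 1 else 0) * Real.exp (1 / 256 * (((G.sampled ω).degree v : ℝ) - μ)) +
      (if Sum.inl v ∈ ω then 1 else 0) *
        Real.exp (-(1 / 256) * (((G.sampled ω).degree v : ℝ) - μ)))) (by
    intro ω
    by_cases hv : Sum.inl v ∈ ω
    · simp only [hv, if_true, one_mul, mul_one]
      refine (max_sub_le_add_exp (b := b / 256) (l := 1 / 256) (by positivity)
        (by norm_num)).trans (le_of_eq ?_)
      ring
    · simp [hv])
  rw [subsetExpect_add, subsetExpect_mul_left, subsetExpect_mul_left, subsetExpect_add,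
    subsetExpect_vertex] at hmono
  refine hmono.trans ?_
  have hs : ∀ l : ℝ, l ^ 2 = 1 / 65536 → p v * Real.exp (l ^ 2 * σ) ≤
      p v * Real.exp (1 / 65536 * (2 * t + b)) := by
    intro l hl
    rw [hl]
    rcases (hp0 v).eq_or_lt with h | h
    · simp [← h]
    · have := hvar h
      gcongr
  have h1 := hA.trans (hs _ (by norm_num))
  have h2 := hB.trans (hs _ (by norm_num))
  -- The shift by `b / 256` is chosen so that `b` cancels in the exponent; what remains is -t/16384
  -- + t/32768.
  have h3 : Real.exp (-(1 / 256) * (t / 64 + b / 256)) * Real.exp (1 / 65536 * (2 * t + b)) =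
      Real.exp (-t / 32768) := by
    rw [← Real.exp_add]; congr 1; ring
  calc _ ≤ b / 256 * p v + 256 * Real.exp (-(1 / 256) * (t / 64 + b / 256)) *
      (p v * Real.exp (1 / 65536 * (2 * t + b)) + p v * Real.exp (1 / 65536 * (2 * t + b))) := by
        gcongr
    _ = p v * (b / 256 + 512 * (Real.exp (-(1 / 256) * (t / 64 + b / 256)) *
          Real.exp (1 / 65536 * (2 * t + b)))) := by ring
    _ = _ := by rw [h3]

/-- Sampling vertices with probabilities `p` and edges with probabilities `w` produces a subgraph
whose degrees are concentrated around `D`, provided that the expected degree of a sampled vertex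
is close to `D` on average. -/
lemma SimpleGraph.exists_concentrated_subgraph (G : SimpleGraph V) {p : V → ℝ} {w : Sym2 V → ℝ}
    (hp0 : ∀ v, 0 ≤ p v) (hp1 : ∀ v, p v ≤ 1) (hw0 : ∀ e, 0 ≤ w e) (hw1 : ∀ e, w e ≤ 1)
    {D t b : ℝ} (ht : 64 ≤ t) (hD : 0 ≤ D)
    (hmean : ∀ v, ∑ u ∈ G.neighborFinset v, p u * w s(v, u) ≤ D)
    (hvar : ∀ v, 0 < p v →
      ∑ u ∈ G.neighborFinset v, p u * w s(v, u) * (1 - p u * w s(v, u)) ≤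
      2 * t + (D - ∑ u ∈ G.neighborFinset v, p u * w s(v, u)))
    (hP : 0 < ∑ v, p v)
    (hloss : ∑ v, p v * (D - ∑ u ∈ G.neighborFinset v, p u * w s(v, u)) ≤ b * ∑ v, p v) :
    ∃ H ≤ G, ∃ S : Finset V, S.Nonempty ∧ (∀ v, v ∉ S → H.degree v = 0) ∧
      (∀ v, (H.degree v : ℝ) ≤ D + t / 32) ∧
      ∑ v ∈ S, max (D - t / 32 - H.degree v) 0 ≤
        (2 * b + 2000 * Real.exp (-t / 32768)) * #S := by
  set μ : V → ℝ := fun v => ∑ u ∈ G.neighborFinset v, p u * w s(v, u) with hμ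
  set β := 2 * b + 2000 * Real.exp (-t / 32768) with hβ
  have hq0 : ∀ i, 0 ≤ Sum.elim p w i := by rintro (i | i); exacts [hp0 i, hw0 i]
  have hq1 : ∀ i, Sum.elim p w i ≤ 1 := by rintro (i | i); exacts [hp1 i, hw1 i]
  -- Positivity of `f ω` is the required average bound. In the factor 3, one unit pays for the
  -- deficiency of a sampled degree and two for trimming, since deleting one edge lowers the degree
  -- sum by 2.
  set f : Finset (V ⊕ Sym2 V) → ℝ := fun ω => ∑ v, ((β - (D - μ v)) *
    (if Sum.inl v ∈ ω then 1 else 0) - 3 * ((if Sum.inl v ∈ ω then 1 else 0) *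
      max (|((G.sampled ω).degree v : ℝ) - μ v| - t / 64) 0)) with hf
  have hexp : 0 < subsetExpect (Sum.elim p w) f := by
    rw [hf, subsetExpect_sum]
    have h1 : ∀ v, (β - (D - μ v)) * p v - 3 * (p v * ((D - μ v) / 256 +
        512 * Real.exp (-t / 32768))) ≤ subsetExpect (Sum.elim p w) (fun ω => (β - (D - μ v)) *
        (if Sum.inl v ∈ ω then 1 else 0) - 3 * ((if Sum.inl v ∈ ω then 1 else 0) *
        max (|((G.sampled ω).degree v : ℝ) - μ v| - t / 64) 0)) := by
      intro v
      rw [subsetExpect_sub, subsetExpect_mul_left, subsetExpect_mul_left, subsetExpect_vertex]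
      have := G.expect_excess_le hp0 hp1 hw0 hw1 (sub_nonneg.2 (hmean v)) v (hvar v)
      linarith
    refine lt_of_lt_of_le ?_ (sum_le_sum fun v _ => h1 v)
    have h2 : ∀ v, (β - (D - μ v)) * p v - 3 * (p v * ((D - μ v) / 256 +
        512 * Real.exp (-t / 32768))) = (β - 1536 * Real.exp (-t / 32768)) * p v -
        (1 + 3 / 256) * (p v * (D - μ v)) := fun v => by ring
    simp only [h2]
    rw [sum_sub_distrib, ← mul_sum, ← mul_sum]
    have h3 := Real.exp_pos (-t / 32768)
    have h4 : 0 ≤ ∑ v, p v * (D - μ v) :=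
      sum_nonneg fun v _ => mul_nonneg (hp0 v) (sub_nonneg.2 (hmean v))
    nlinarith [mul_pos h3 hP]
  obtain ⟨ω, hω⟩ : ∃ ω, 0 < f ω := by
    by_contra! h
    have := subsetExpect_mono hq0 hq1 h
    rw [subsetExpect_const] at this
    linarith
  set G₁ := G.sampled ω with hG₁
  set S : Finset V := univ.filter fun v => Sum.inl v ∈ ω with hS
  have hdeg0 : ∀ v, v ∉ S → G₁.degree v = 0 := by
    intro v hv
    by_contra h
    obtain ⟨u, hu⟩ := (G₁.degree_pos_iff_exists_adj v).1 (Nat.pos_of_ne_zero h)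
    exact hv (by simpa [hS] using hu.2.1)
  set K := ⌊D + t / 32⌋₊ with hK
  obtain ⟨H, hH, hHK, hHsum⟩ := G₁.exists_le_degree_le K
  have hfS : f ω = ∑ v ∈ S, (β - (D - μ v) - 3 * max (|(G₁.degree v : ℝ) - μ v| - t / 64) 0) := by
    rw [hf, hS, sum_filter]
    refine sum_congr rfl fun v _ => ?_
    split_ifs
    · rw [mul_one, one_mul]
    · simp
  rw [hfS] at hω
  refine ⟨H, hH.trans (G.sampled_le ω), S, ?_, ?_, ?_, ?_⟩
  · by_contra h
    rw [not_nonempty_iff_eq_empty] at h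
    simp [h] at hω
  · intro v hv
    exact Nat.le_zero.1 ((SimpleGraph.degree_mono hH v).trans (hdeg0 v hv).le)
  · intro v
    exact (Nat.cast_le.2 (hHK v)).trans (Nat.floor_le (by positivity))
  · have h1 : ∀ v, max (D - t / 32 - (G₁.degree v : ℝ)) 0 + 2 * ((G₁.degree v - K : ℕ) : ℝ) ≤
        (D - μ v) + 3 * max (|(G₁.degree v : ℝ) - μ v| - t / 64) 0 := by
      intro v
      have hm := hmean v
      have hx0 := le_max_right (|(G₁.degree v : ℝ) - μ v| - t / 64) 0
      have hx1 := le_max_left (|(G₁.degree v : ℝ) - μ v| - t / 64) 0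
      have hy1 := le_abs_self ((G₁.degree v : ℝ) - μ v)
      have hy2 := neg_abs_le ((G₁.degree v : ℝ) - μ v)
      have hz1 : max (D - t / 32 - (G₁.degree v : ℝ)) 0 ≤
          (D - μ v) + max (|(G₁.degree v : ℝ) - μ v| - t / 64) 0 := by
        refine max_le ?_ ?_ <;> change μ v ≤ D at hm <;> linarith
      have hz2 : ((G₁.degree v - K : ℕ) : ℝ) ≤
          max (|(G₁.degree v : ℝ) - μ v| - t / 64) 0 := by
        rcases le_or_gt (G₁.degree v) K with h | h
        · simp [Nat.sub_eq_zero_of_le h]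
        · rw [Nat.cast_sub h.le]
          have := Nat.lt_floor_add_one (D + t / 32)
          change μ v ≤ D at hm
          linarith
      linarith
    have h2 : ∑ v ∈ S, max (D - t / 32 - (H.degree v : ℝ)) 0 ≤
        ∑ v ∈ S, (max (D - t / 32 - (G₁.degree v : ℝ)) 0 +
          ((G₁.degree v : ℝ) - H.degree v)) := by
      refine sum_le_sum fun v _ => ?_
      have h0 : (H.degree v : ℝ) ≤ G₁.degree v := Nat.cast_le.2 (SimpleGraph.degree_mono hH v)
      have := le_max_left (D - t / 32 - (G₁.degree v : ℝ)) 0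
      have := le_max_right (D - t / 32 - (G₁.degree v : ℝ)) 0
      refine max_le ?_ ?_ <;> linarith
    have h3 : ∑ v ∈ S, ((G₁.degree v : ℝ) - H.degree v) ≤
        ∑ v ∈ S, 2 * ((G₁.degree v - K : ℕ) : ℝ) := by
      rw [sum_subset (subset_univ S) (by
        intro v _ hv
        have := SimpleGraph.degree_mono hH v
        rw [hdeg0 v hv] at this
        simp [hdeg0 v hv, Nat.le_zero.1 this]),
        sum_subset (f := fun v => 2 * ((G₁.degree v - K : ℕ) : ℝ)) (subset_univ S) (by
        intro v _ hv
        simp [hdeg0 v hv]), sum_sub_distrib, ← mul_sum, sub_le_iff_le_add']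
      exact_mod_cast hHsum
    have h4 := sum_le_sum (s := S) fun v _ => h1 v
    simp only [sum_add_distrib, sum_sub_distrib, ← mul_sum, sum_const, nsmul_eq_mul] at h2 h3 h4 hω
    linarith

end Sampling

/-! ### Iterated regularisation down to a constant window. -/

section NearlyRegular

variable {V : Type*} [Fintype V]

/-- The edges of `G` lie inside the non-empty set `S`, all degrees are at most `L`, and the
degrees in `S` fall below `L - t` by at most `β` on average. -/
structure SimpleGraph.NearlyRegular (G : SimpleGraph V) (S : Finset V) (L t β : ℝ) : Prop where
  nonempty : S.Nonempty
  degree_eq_zero : ∀ v, v ∉ S → G.degree v = 0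
  degree_le : ∀ v, (G.degree v : ℝ) ≤ L
  sum_le : ∑ v ∈ S, max (L - t - G.degree v) 0 ≤ β * #S

lemma SimpleGraph.sum_sum_neighborFinset (G : SimpleGraph V) (f : V → ℝ) :
    ∑ v, ∑ u ∈ G.neighborFinset v, f u = ∑ v, (G.degree v : ℝ) * f v := by
  have h1 : ∀ v, ∑ u ∈ G.neighborFinset v, f u = ∑ u, if G.Adj v u then f u else 0 := by
    intro v
    rw [← sum_filter]
    refine sum_congr ?_ fun _ _ => rfl
    ext u
    rw [SimpleGraph.mem_neighborFinset]
    simp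
  simp only [h1]
  rw [sum_comm]
  refine sum_congr rfl fun v _ => ?_
  rw [← sum_filter, sum_const, nsmul_eq_mul, ← SimpleGraph.card_neighborFinset_eq_degree]
  congr 3
  ext u
  rw [SimpleGraph.mem_neighborFinset]
  simp [SimpleGraph.adj_comm]

/-- Vertex probability deg v / L times edge probability DL/(deg u · deg v) makes each neighbour of v
contribute D / deg v, hence mean degree exactly D. The product condition is what keeps the edge
probabilities at most 1. -/
lemma SimpleGraph.exists_nearlyRegular_of_mul_le (G : SimpleGraph V) {L D : ℝ} (hD : 128 ≤ D)
    (hL : ∀ v, (G.degree v : ℝ) ≤ L)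
    (hG : ∀ u v, G.Adj u v → D * L ≤ G.degree u * G.degree v) (hne : ∃ u v, G.Adj u v) :
    ∃ H ≤ G, ∃ S, H.NearlyRegular S (D + D / 64) (D / 32) (2000 * Real.exp (-D / 65536)) := by
  obtain ⟨u₀, v₀, h₀⟩ := hne
  have hpos : ∀ u v, G.Adj u v → (0 : ℝ) < G.degree v := fun u v h =>
    Nat.cast_pos.2 ((G.degree_pos_iff_exists_adj v).2 ⟨u, h.symm⟩)
  have hL0 : 0 < L := (hpos u₀ v₀ h₀).trans_le (hL v₀)
  set p : V → ℝ := fun v => G.degree v / L with hp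
  set w : Sym2 V → ℝ := Sym2.lift ⟨fun u v => min 1 (D * L / (G.degree u * G.degree v)),
    fun u v => by simp only [mul_comm (G.degree u : ℝ)]⟩ with hw
  have hπ : ∀ v, ∀ u ∈ G.neighborFinset v, p u * w s(v, u) = D / G.degree v := by
    intro v u hu
    rw [SimpleGraph.mem_neighborFinset] at hu
    have h1 := hpos _ _ hu
    have h2 := hpos _ _ hu.symm
    have h3 : D * L / (G.degree v * G.degree u) ≤ 1 :=
      (div_le_one (mul_pos h2 h1)).2 (hG v u hu)
    simp only [hp, hw, Sym2.lift_mk, min_eq_right h3]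
    field_simp
  have hmean : ∀ v, p v = 0 ∨ ∑ u ∈ G.neighborFinset v, p u * w s(v, u) = D := by
    intro v
    by_cases hv : G.degree v = 0
    · left; simp [hp, hv]
    · right
      rw [sum_congr rfl (hπ v), sum_const, SimpleGraph.card_neighborFinset_eq_degree, nsmul_eq_mul]
      field_simp
  have hmean' : ∀ v, ∑ u ∈ G.neighborFinset v, p u * w s(v, u) ≤ D := by
    intro v
    by_cases hv : G.degree v = 0
    · rw [sum_congr rfl (hπ v), hv]
      simp; linarith
    · rcases hmean v with h | h
      · simp [hp, hv, hL0.ne'] at h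
      · exact h.le
  have hp0 : ∀ v, 0 ≤ p v := fun v => by positivity
  have hw0 : ∀ e, 0 ≤ w e := by
    intro e
    induction e with | _ u v => simp only [hw, Sym2.lift_mk]; positivity
  obtain ⟨H, hH, S, hS, h1, h2, h3⟩ := G.exists_concentrated_subgraph (p := p) (w := w) (D := D)
    (t := D / 2) (b := 0) hp0
    (fun v => (div_le_one hL0).2 (hL v)) hw0 (by
      intro e
      induction e with | _ u v => exact min_le_left _ _)
    (by linarith) (by linarith) hmean' (by
      intro v hv
      rcases hmean v with h | h
      · exact absurd h hv.ne'
      · rw [h]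
        have : ∑ u ∈ G.neighborFinset v, p u * w s(v, u) * (1 - p u * w s(v, u)) ≤
            ∑ u ∈ G.neighborFinset v, p u * w s(v, u) :=
          sum_le_sum fun u _ => mul_le_of_le_one_right (mul_nonneg (hp0 u) (hw0 _))
            (by linarith [mul_nonneg (hp0 u) (hw0 s(v, u))])
        linarith)
    (sum_pos' (fun v _ => hp0 v) ⟨v₀, mem_univ _, div_pos (hpos _ _ h₀) hL0⟩)
    (by
      rw [sum_eq_zero, zero_mul]
      intro v _
      rcases hmean v with h | h
      · rw [h, zero_mul]
      · rw [h, sub_self, mul_zero])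
  refine ⟨H, hH, S, hS, h1, fun v => ?_, ?_⟩
  · have := h2 v; linarith
  · convert h3 using 3
    · congr 1; ring
    · rw [mul_zero, zero_add]; congr 2; ring

/-- Edge weights `g u * g v` tame vertices above m = L - t, and vertex probabilities deg / L make
low-degree vertices rare. Typical mean degrees become m²/L, at most 2t below L, while the window
shrinks by a factor 16. -/
lemma SimpleGraph.NearlyRegular.exists_step {G : SimpleGraph V} {S : Finset V} {L t β : ℝ}
    (h : G.NearlyRegular S L t β) (ht : 64 ≤ t) (htL : 4 * t ≤ L) (hβ : β ≤ L / 4) :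
    ∃ H ≤ G, ∃ S', H.NearlyRegular S' ((L - t) ^ 2 / L + t / 32) (t / 16)
      (8 * β + 2000 * Real.exp (-t / 32768)) := by
  have hL0 : 0 < L := by linarith
  set m := L - t with hm
  have hm0 : 0 < m := by linarith
  have hmL : m ≤ L := by linarith
  set g : V → ℝ := fun v => m / max m (G.degree v) with hg
  set a : V → ℝ := fun v => min m (G.degree v) with ha
  have hg0 : ∀ v, 0 ≤ g v := fun v => by positivity
  have hg1 : ∀ v, g v ≤ 1 := fun v => div_le_one_of_le₀ (le_max_left _ _) (by positivity)
  have hga : ∀ v, G.degree v * g v = a v := by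
    intro v
    simp only [hg, ha]
    rcases le_total m (G.degree v : ℝ) with hv | hv
    · have : (0 : ℝ) < G.degree v := hm0.trans_le hv
      rw [max_eq_right hv, min_eq_left hv]; field_simp
    · rw [max_eq_left hv, min_eq_right hv]; field_simp
  have ha0 : ∀ v, 0 ≤ a v := fun v => by positivity
  have ham : ∀ v, a v ≤ m := fun v => min_le_left _ _
  set p : V → ℝ := fun v => G.degree v / L with hp
  set w : Sym2 V → ℝ := Sym2.lift ⟨fun u v => g u * g v, fun u v => mul_comm _ _⟩ with hw
  have hp0 : ∀ v, 0 ≤ p v := fun v => by positivity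
  have hp1 : ∀ v, p v ≤ 1 := fun v => (div_le_one hL0).2 (h.degree_le v)
  have hw0 : ∀ e, 0 ≤ w e := by
    intro e
    induction e with | _ u v => exact mul_nonneg (hg0 u) (hg0 v)
  have hw1 : ∀ e, w e ≤ 1 := by
    intro e
    induction e with | _ u v => exact mul_le_one₀ (hg1 u) (hg0 v) (hg1 v)
  have hπ : ∀ u v, p u * w s(v, u) = g v * (a u / L) := by
    intro u v
    rw [← hga]
    simp only [hp, hw, Sym2.lift_mk]
    ring
  have hdeg : ∀ v, (#(G.neighborFinset v) : ℝ) = G.degree v := fun v => by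
    rw [SimpleGraph.card_neighborFinset_eq_degree]
  have hmean : ∀ v, ∑ u ∈ G.neighborFinset v, p u * w s(v, u) ≤ m ^ 2 / L := by
    intro v
    simp only [hπ]
    calc ∑ u ∈ G.neighborFinset v, g v * (a u / L) ≤ ∑ u ∈ G.neighborFinset v, g v * (m / L) := by
          refine sum_le_sum fun u _ => ?_
          have := ham u
          have := hg0 v
          gcongr
      _ = a v * (m / L) := by rw [sum_const, nsmul_eq_mul, hdeg, ← hga]; ring
      _ ≤ m * (m / L) := by have := ham v; gcongr
      _ = m ^ 2 / L := by ring
  have hD : L ≤ 2 * t + m ^ 2 / L := by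
    have : m ^ 2 / L = L - 2 * t + t ^ 2 / L := by rw [hm]; field_simp; ring
    have : 0 ≤ t ^ 2 / L := by positivity
    linarith
  have hsumS : ∀ f : V → ℝ, ∑ v, (G.degree v : ℝ) * f v = ∑ v ∈ S, (G.degree v : ℝ) * f v := by
    intro f
    refine (sum_subset (subset_univ S) fun v _ hv => ?_).symm
    rw [h.degree_eq_zero v hv]; simp
  have hP : (#S : ℝ) / 2 ≤ ∑ v, p v := by
    have h1 : ∑ v, p v = (∑ v ∈ S, (G.degree v : ℝ)) / L := by
      have := hsumS fun _ => 1
      simp only [mul_one] at this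
      rw [← this, sum_div]
    have h2 : ∑ v ∈ S, (m - max (L - t - G.degree v) 0) ≤ ∑ v ∈ S, (G.degree v : ℝ) :=
      sum_le_sum fun v _ => by linarith [le_max_left (L - t - (G.degree v : ℝ)) 0]
    rw [sum_sub_distrib, sum_const, nsmul_eq_mul] at h2
    rw [h1, le_div_iff₀ hL0]
    have h3 := h.sum_le
    have h4 : (#S : ℝ) * (L / 2) ≤ #S * (m - β) := by gcongr; linarith
    linarith
  have hS0 : (0 : ℝ) < #S := Nat.cast_pos.2 h.nonempty.card_pos
  have hβ0 : 0 ≤ β := by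
    have : 0 ≤ ∑ v ∈ S, max (L - t - (G.degree v : ℝ)) 0 := sum_nonneg fun v _ => le_max_right _ _
    exact nonneg_of_mul_nonneg_left (this.trans h.sum_le) hS0
  have hloss : ∑ v, p v * (m ^ 2 / L - ∑ u ∈ G.neighborFinset v, p u * w s(v, u)) ≤
      4 * β * ∑ v, p v := by
    -- The two sides differ by (m - a v)(m · deg v - A)/L² ≥ 0, so the loss is bounded by the
    -- deficits of v and of its neighbours; double counting makes the two totals equal.
    have h1 : ∀ v, p v * (m ^ 2 / L - ∑ u ∈ G.neighborFinset v, p u * w s(v, u)) ≤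
        m / L ^ 2 * (G.degree v * (m - a v)) + m / L ^ 2 * ∑ u ∈ G.neighborFinset v, (m - a u) := by
      intro v
      simp only [hπ]
      rw [← mul_sum, mul_sub, show p v * (g v * ∑ u ∈ G.neighborFinset v, a u / L) =
        (G.degree v * g v) / L * ∑ u ∈ G.neighborFinset v, a u / L by simp only [hp]; ring, hga,
        ← sum_div, sum_sub_distrib, sum_const, nsmul_eq_mul, hdeg]
      set A := ∑ u ∈ G.neighborFinset v, a u
      have h2 : A ≤ G.degree v * m := by
        rw [← hdeg, ← nsmul_eq_mul]
        exact sum_le_card_nsmul _ _ _ fun u _ => ham u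
      have h3 : m / L ^ 2 * (G.degree v * (m - a v)) + m / L ^ 2 * (G.degree v * m - A) -
        (p v * (m ^ 2 / L) - a v / L * (A / L)) = (m - a v) * (G.degree v * m - A) / L ^ 2 := by
        simp only [hp]; field_simp; ring
      have h4 : 0 ≤ (m - a v) * (G.degree v * m - A) / L ^ 2 :=
        div_nonneg (mul_nonneg (sub_nonneg.2 (ham v)) (sub_nonneg.2 h2)) (by positivity)
      linarith
    have h5 := sum_le_sum (s := univ) fun v _ => h1 v
    rw [sum_add_distrib, ← mul_sum, ← mul_sum, G.sum_sum_neighborFinset fun u => m - a u, hsumS]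
      at h5
    have h6 : ∑ v ∈ S, (G.degree v : ℝ) * (m - a v) ≤ L * (β * #S) := by
      refine le_trans ?_ (mul_le_mul_of_nonneg_left h.sum_le hL0.le)
      rw [mul_sum]
      refine sum_le_sum fun v _ => ?_
      have h7 : m - a v = max (L - t - (G.degree v : ℝ)) 0 := by
        simp only [ha]
        rcases le_total m (G.degree v : ℝ) with hv | hv
        · rw [min_eq_left hv, max_eq_right (by linarith), sub_self]
        · rw [min_eq_right hv, max_eq_left (by linarith)]
      rw [← h7]
      exact mul_le_mul_of_nonneg_right (h.degree_le v) (sub_nonneg.2 (ham v))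
    have h8 : m / L ^ 2 * ∑ v ∈ S, (G.degree v : ℝ) * (m - a v) ≤ β * #S := by
      calc _ ≤ L / L ^ 2 * (L * (β * #S)) := by
            gcongr
            exact sum_nonneg fun v _ => mul_nonneg (Nat.cast_nonneg _) (sub_nonneg.2 (ham v))
        _ = β * #S := by field_simp
    have h9 := mul_le_mul_of_nonneg_left hP hβ0
    linarith
  obtain ⟨H, hH, S', hS', h1, h2, h3⟩ := G.exists_concentrated_subgraph (p := p) (w := w)
    (D := m ^ 2 / L) (t := t) (b := 4 * β) hp0 hp1 hw0 hw1 ht (by positivity) hmean (by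
      intro v _
      -- Bounding q(1 - q) by 1 - q controls the variance by the expected number of lost neighbours,
      -- which is of order t up to the deficit of the mean, instead of order L.
      have h1 : ∑ u ∈ G.neighborFinset v, p u * w s(v, u) * (1 - p u * w s(v, u)) ≤
          ∑ u ∈ G.neighborFinset v, (1 - p u * w s(v, u)) := by
        refine sum_le_sum fun u _ => ?_
        have h2 := mul_le_one₀ (hp1 u) (hw0 s(v, u)) (hw1 s(v, u))
        exact mul_le_of_le_one_left (sub_nonneg.2 h2) h2
      rw [sum_sub_distrib, sum_const, nsmul_eq_mul, hdeg, mul_one] at h1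
      linarith [h.degree_le v])
    (lt_of_lt_of_le (by positivity) hP) hloss
  refine ⟨H, hH, S', hS', h1, h2, ?_⟩
  convert h3 using 3
  · congr 1; ring
  · ring

/-- The invariant tβ ≤ 1 survives a round: tβ is at most halved and the exponential term adds at
most 1/2. The drops in `L` form a geometric series totalling at most 3t. -/
lemma SimpleGraph.NearlyRegular.exists_of_mul_le_one {T : ℝ} (hT : 64 ≤ T)
    (hT' : ∀ t : ℝ, T ≤ t → 250 * (t * Real.exp (-t / 32768)) ≤ 1) (n : ℕ) :
    ∀ {G : SimpleGraph V} {S : Finset V} {L t β : ℝ}, G.NearlyRegular S L t β → 1 ≤ t →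
      t ≤ 16 ^ n * T → t * β ≤ 1 → 4 * t ≤ L →
      ∃ H ≤ G, ∃ S' L', L - 3 * t ≤ L' ∧ H.NearlyRegular S' L' T 1 := by
  have base : ∀ {G : SimpleGraph V} {S : Finset V} {L t β : ℝ}, G.NearlyRegular S L t β → 1 ≤ t →
      t ≤ T → t * β ≤ 1 → 4 * t ≤ L →
      ∃ H ≤ G, ∃ S' L', L - 3 * t ≤ L' ∧ H.NearlyRegular S' L' T 1 := by
    intro G S L t β h h1 h2 h3 h4
    refine ⟨G, le_rfl, S, L, by linarith, h.nonempty, h.degree_eq_zero, h.degree_le, ?_⟩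
    have hβ : β ≤ 1 := by
      by_contra! hβ
      nlinarith
    calc _ ≤ ∑ v ∈ S, max (L - t - (G.degree v : ℝ)) 0 :=
          sum_le_sum fun v _ => max_le_max (by linarith) le_rfl
      _ ≤ β * #S := h.sum_le
      _ ≤ 1 * #S := by gcongr
  induction n with
  | zero => intro G S L t β h h1 h2 h3 h4; exact base h h1 (by simpa using h2) h3 h4
  | succ n ih =>
    intro G S L t β h h1 h2 h3 h4
    rcases le_or_gt t T with htT | htT
    · exact base h h1 htT h3 h4
    have hL : 0 < L := by linarith
    have hβ : β ≤ 1 := by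
      by_contra! hβ
      nlinarith
    obtain ⟨H, hH, S', h'⟩ := h.exists_step (by linarith) h4 (by linarith)
    have hL' : L - 2 * t ≤ (L - t) ^ 2 / L := by
      rw [le_div_iff₀ hL]; nlinarith [sq_nonneg t]
    obtain ⟨H', hH', S'', L'', h5, h6⟩ := ih h' (by linarith)
      (by rw [pow_succ] at h2; linarith) (by
        have := hT' t htT.le
        nlinarith) (by linarith)
    exact ⟨H', hH'.trans hH, S'', L'', by linarith, h6⟩

/-- A graph in which the product of the degrees of adjacent vertices is at least `D` times a bound
on the degrees has a subgraph whose average degree is within a constant of its maximum degree. -/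
lemma SimpleGraph.exists_almost_regular : ∃ c : ℝ, 0 < c ∧ ∀ {V : Type} [Fintype V]
    (G : SimpleGraph V) {L D : ℝ}, c ≤ D → (∀ v, (G.degree v : ℝ) ≤ L) →
    (∀ u v, G.Adj u v → D * L ≤ G.degree u * G.degree v) → (∃ u v, G.Adj u v) →
    ∃ H ≤ G, ∃ (S : Finset V) (L' : ℝ), S.Nonempty ∧ D / 2 ≤ L' ∧ (∀ v, v ∉ S → H.degree v = 0) ∧
      (∀ v, (H.degree v : ℝ) ≤ L') ∧ (L' - c) * #S ≤ ∑ v ∈ S, (H.degree v : ℝ) := by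
  have hlim : Filter.Tendsto (fun t : ℝ => 250 * (t * Real.exp (-t / 32768))) Filter.atTop
      (nhds 0) := by
    have h1 := (Real.tendsto_pow_mul_exp_neg_atTop_nhds_zero 1).comp
      (Filter.tendsto_id.atTop_div_const (show (0 : ℝ) < 32768 by norm_num))
    have h2 := h1.const_mul (250 * 32768)
    rw [mul_zero] at h2
    refine h2.congr fun t => ?_
    simp only [Function.comp, id, pow_one, neg_div]
    ring
  obtain ⟨T₀, hT₀⟩ := Filter.eventually_atTop.1 (hlim.eventually (gt_mem_nhds one_pos))
  set T := max T₀ 64 with hT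
  have hT64 : 64 ≤ T := le_max_right _ _
  have hT' : ∀ t : ℝ, T ≤ t → 250 * (t * Real.exp (-t / 32768)) ≤ 1 :=
    fun t ht => (hT₀ t ((le_max_left _ _).trans ht)).le
  refine ⟨2 * T, by linarith, ?_⟩
  intro V _ G L D hD hL hG hne
  obtain ⟨H, hH, S, h⟩ := G.exists_nearlyRegular_of_mul_le (by linarith) hL hG hne
  obtain ⟨n, hn⟩ := pow_unbounded_of_one_lt (D / 32) (show (1 : ℝ) < 16 by norm_num)
  obtain ⟨H', hH', S', L', h1, h2⟩ := h.exists_of_mul_le_one hT64 hT' n (by linarith)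
    (hn.le.trans (le_mul_of_one_le_right (by positivity) (by linarith))) (by
      have := hT' (D / 2) (by linarith)
      rw [show -(D / 2) / 32768 = -D / 65536 by ring] at this
      linarith) (by linarith)
  refine ⟨H', hH'.trans hH, S', L', h2.nonempty, by linarith, h2.degree_eq_zero, h2.degree_le, ?_⟩
  have h3 : ∑ v ∈ S', (L' - T - max (L' - T - (H'.degree v : ℝ)) 0) ≤ ∑ v ∈ S', (H'.degree v : ℝ) :=
    sum_le_sum fun v _ => by linarith [le_max_left (L' - T - (H'.degree v : ℝ)) 0]
  rw [sum_sub_distrib, sum_const, nsmul_eq_mul] at h3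
  have h4 := h2.sum_le
  have h5 : (L' - 2 * T) * #S' ≤ (L' - T - 1) * #S' :=
    mul_le_mul_of_nonneg_right (by linarith) (Nat.cast_nonneg _)
  linarith

end NearlyRegular

/-! ### König's edge colouring and selection of matchings. -/

section Layers

variable {V : Type*} [Fintype V]

/-- Hall's condition follows by counting the mass of the rows in `A`, which lies within the columns
they meet. -/
lemma exists_perm_of_sum_eq {k : ℕ} (hk : 0 < k) (M : V → V → ℕ) (hr : ∀ u, ∑ v, M u v = k)
    (hc : ∀ v, ∑ u, M u v = k) : ∃ σ : Equiv.Perm V, ∀ u, 0 < M u (σ u) := by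
  obtain ⟨f, hf, hf'⟩ := (Finset.all_card_le_biUnion_card_iff_exists_injective
    (fun u => univ.filter fun v => 0 < M u v)).1 (by
      intro A
      set B := A.biUnion fun u => univ.filter fun v => 0 < M u v with hB
      refine Nat.le_of_mul_le_mul_left ?_ hk
      calc k * #A = ∑ u ∈ A, ∑ v, M u v := by
            rw [sum_congr rfl fun u _ => hr u, sum_const, smul_eq_mul, mul_comm]
        _ = ∑ u ∈ A, ∑ v ∈ B, M u v := by
            refine sum_congr rfl fun u hu => (sum_subset (subset_univ B) fun v _ hv => ?_).symm
            by_contra h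
            exact hv (mem_biUnion.2 ⟨u, hu, by simpa using Nat.pos_of_ne_zero h⟩)
        _ = ∑ v ∈ B, ∑ u ∈ A, M u v := sum_comm
        _ ≤ ∑ v ∈ B, k := sum_le_sum fun v _ =>
            (sum_le_sum_of_subset (subset_univ A)).trans (hc v).le
        _ = k * #B := by rw [sum_const, smul_eq_mul, mul_comm])
  refine ⟨Equiv.ofBijective f (Finite.injective_iff_bijective.1 hf), fun u => ?_⟩
  simpa using hf' u

lemma exists_eq_sum_perm (k : ℕ) : ∀ M : V → V → ℕ, (∀ u, ∑ v, M u v = k) →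
    (∀ v, ∑ u, M u v = k) → ∃ σ : Fin k → Equiv.Perm V,
      ∀ u v, M u v = ∑ i, if σ i u = v then 1 else 0 := by
  induction k with
  | zero =>
    intro M hr _
    refine ⟨Fin.elim0, fun u v => ?_⟩
    simpa using (sum_eq_zero_iff.1 (hr u)) v (mem_univ v)
  | succ k ih =>
    intro M hr hc
    obtain ⟨τ, hτ⟩ := exists_perm_of_sum_eq k.succ_pos M hr hc
    have hM : ∀ u v, M u v = (M u v - if τ u = v then 1 else 0) + if τ u = v then 1 else 0 := by
      intro u v
      split_ifs with h
      · subst h; have := hτ u; omega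
      · omega
    obtain ⟨σ, hσ⟩ := ih (fun u v => M u v - if τ u = v then 1 else 0) (by
        intro u
        have h := hr u
        rw [sum_congr rfl fun v _ => hM u v, sum_add_distrib] at h
        simpa using h) (by
        intro v
        have h := hc v
        rw [sum_congr rfl fun u _ => hM u v, sum_add_distrib] at h
        have h1 : ∑ u, (if τ u = v then 1 else 0) = 1 := by
          simp [← Equiv.eq_symm_apply]
        omega)
    refine ⟨Fin.cons τ σ, fun u v => ?_⟩
    rw [Fin.sum_univ_succ]
    simp only [Fin.cons_zero, Fin.cons_succ]
    rw [hM u v, hσ u v, add_comm]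

/-- **König's edge colouring theorem**: the edges of a bipartite graph with degrees at most `k`
split into `k` matchings, where `E i v` says that the matching `i` covers `v`. -/
lemma SimpleGraph.exists_matchings (G : SimpleGraph V) (A : Set V)
    (hA : ∀ u v, G.Adj u v → (u ∈ A ↔ v ∉ A)) {k : ℕ} (hk : ∀ v, G.degree v ≤ k) :
    ∃ E : Fin k → V → Prop, (∀ v, G.degree v = #{i | E i v}) ∧
      ∀ I : Finset (Fin k), ∃ H ≤ G, ∀ v, H.degree v = #{i ∈ I | E i v} := by
  -- The diagonal pads every row and column sum to k, so fixed points of the permutations mark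
  -- uncovered vertices.
  set M : V → V → ℕ := fun u v => (if G.Adj u v then 1 else 0) +
    if u = v then k - G.degree u else 0 with hM
  have hr : ∀ u, ∑ v, M u v = k := by
    intro u
    have h1 : (∑ v, if G.Adj u v then 1 else 0) = G.degree u := by
      rw [← card_filter, ← SimpleGraph.card_neighborFinset_eq_degree]
      congr 1
      ext v
      rw [SimpleGraph.mem_neighborFinset]
      simp
    simp only [hM]
    rw [sum_add_distrib, h1]
    have := hk u
    simp; omega
  have hMs : ∀ u v, M u v = M v u := by
    intro u v
    simp only [hM, SimpleGraph.adj_comm]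
    congr 1
    by_cases h : u = v
    · subst h; rfl
    · simp [h, Ne.symm h]
  obtain ⟨σ, hσ⟩ := exists_eq_sum_perm k M hr fun v => by
    rw [← hr v]; exact sum_congr rfl fun u _ => hMs u v
  have hadj : ∀ i u, σ i u ≠ u → G.Adj u (σ i u) := by
    intro i u h
    by_contra hn
    have h1 := hσ u (σ i u)
    simp only [hM, hn, if_false, h.symm, add_zero] at h1
    have := (sum_eq_zero_iff.1 h1.symm) i (mem_univ i)
    simp at this
  have huniq : ∀ u v, u ≠ v → ∀ i j, σ i u = v → σ j u = v → i = j := by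
    intro u v huv i j hi hj
    by_contra hij
    have h1 := hσ u v
    rw [← card_filter] at h1
    have h2 : #{i, j} ≤ #{i | σ i u = v} := card_le_card (by
      intro x hx
      rcases (by simpa using hx : x = i ∨ x = j) with rfl | rfl <;> simpa)
    rw [card_pair hij, ← h1] at h2
    simp only [hM, huv, if_false, add_zero] at h2
    split_ifs at h2 <;> omega
  obtain ⟨E, hE⟩ : ∃ E : Fin k → V → Prop, ∀ i v, E i v ↔ σ i v ≠ v := ⟨_, fun _ _ => Iff.rfl⟩
  refine ⟨E, fun v => ?_, fun I => ?_⟩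
  · have h1 := hσ v v
    rw [← card_filter] at h1
    simp only [hM, SimpleGraph.irrefl, if_false, if_true, zero_add] at h1
    have h2 := card_filter_add_card_filter_not (s := (univ : Finset (Fin k)))
      (fun i => σ i v = v)
    rw [card_univ, Fintype.card_fin] at h2
    have := hk v
    have h3 : #{i | E i v} = #{i | ¬ σ i v = v} := by
      congr 1
      ext i
      simp [hE]
    omega
  -- Each permutation may move both ends of an edge; using only the arrows that leave `A` turns it
  -- into a matching.
  · obtain ⟨H, hH⟩ : ∃ H : SimpleGraph V, ∀ u v, H.Adj u v ↔ G.Adj u v ∧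
        ∃ i ∈ I, (u ∈ A ∧ σ i u = v) ∨ (v ∈ A ∧ σ i v = u) :=
      ⟨{ Adj := fun u v => G.Adj u v ∧ ∃ i ∈ I, (u ∈ A ∧ σ i u = v) ∨ (v ∈ A ∧ σ i v = u)
         symm := ⟨fun u v ⟨h, i, hi, h'⟩ => ⟨h.symm, i, hi, h'.symm⟩⟩
         loopless := ⟨fun v h => G.loopless.irrefl v h.1⟩ }, fun _ _ => Iff.rfl⟩
    refine ⟨H, fun u v h => ((hH u v).1 h).1, fun v => ?_⟩
    rw [← SimpleGraph.card_neighborFinset_eq_degree]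
    symm
    by_cases hv : v ∈ A
    · refine card_bij (fun i _ => σ i v) ?_ ?_ ?_
      · intro i hi
        rw [mem_filter, hE] at hi
        rw [SimpleGraph.mem_neighborFinset, hH]
        exact ⟨hadj i v hi.2, i, hi.1, Or.inl ⟨hv, rfl⟩⟩
      · intro i hi j hj hij
        rw [mem_filter, hE] at hi
        exact huniq v (σ i v) hi.2.symm i j rfl hij.symm
      · intro u hu
        rw [SimpleGraph.mem_neighborFinset, hH] at hu
        obtain ⟨hvu, i, hi, ⟨_, h⟩ | ⟨h, _⟩⟩ := hu
        · exact ⟨i, mem_filter.2 ⟨hi, (hE i v).2 (h.trans_ne hvu.ne')⟩, h⟩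
        · exact absurd h ((hA v u hvu).1 hv)
    · refine card_bij (fun i _ => (σ i).symm v) ?_ ?_ ?_
      · intro i hi
        rw [mem_filter, hE] at hi
        have h1 : σ i ((σ i).symm v) ≠ (σ i).symm v := by
          intro h
          apply hi.2
          rw [Equiv.apply_symm_apply] at h
          conv_lhs => rw [h]
          rw [Equiv.apply_symm_apply]
        have h2 := hadj i _ h1
        rw [Equiv.apply_symm_apply] at h2
        rw [SimpleGraph.mem_neighborFinset, hH]
        exact ⟨h2.symm, i, hi.1, Or.inr ⟨(hA _ _ h2).2 hv, Equiv.apply_symm_apply _ _⟩⟩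
      · intro i hi j hj hij
        rw [mem_filter, hE] at hi
        refine huniq ((σ i).symm v) v ?_ i j (Equiv.apply_symm_apply _ _) (by
          rw [show (σ i).symm v = (σ j).symm v from hij, Equiv.apply_symm_apply])
        intro h
        apply hi.2
        conv_lhs => rw [← h]
        rw [Equiv.apply_symm_apply]
      · intro u hu
        rw [SimpleGraph.mem_neighborFinset, hH] at hu
        obtain ⟨hvu, i, hi, ⟨h, _⟩ | ⟨_, h⟩⟩ := hu
        · exact absurd h hv
        · refine ⟨i, mem_filter.2 ⟨hi, (hE i v).2 ?_⟩, by rw [← h, Equiv.symm_apply_apply]⟩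
          intro h'
          have := (σ i).injective (h'.trans h.symm)
          exact hvu.ne this

lemma exists_card_eq_mul_sum_le {n : ℕ} (f : Fin n → ℕ) {k : ℕ} (hk : k ≤ n) :
    ∃ I : Finset (Fin n), #I = k ∧ k * ∑ i, f i ≤ n * ∑ i ∈ I, f i := by
  induction hk using Nat.decreasingInduction with
  | self => exact ⟨univ, by simp, le_rfl⟩
  | of_succ k hk ih =>
    obtain ⟨I, hI, h⟩ := ih
    obtain ⟨i, hi, hmin⟩ := exists_min_image I f (card_pos.1 (by omega))
    refine ⟨I.erase i, by rw [card_erase_of_mem hi, hI]; rfl, ?_⟩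
    have h1 := add_sum_erase I f hi
    have h2 : k * f i ≤ ∑ j ∈ I.erase i, f j := by
      have := card_nsmul_le_sum (I.erase i) f (f i) fun j hj => hmin j (mem_of_mem_erase hj)
      rwa [card_erase_of_mem hi, hI, Nat.add_sub_cancel, smul_eq_mul] at this
    rw [← h1] at h
    refine le_of_mul_le_mul_left (a := k + 1) ?_ k.succ_pos
    nlinarith

lemma SimpleGraph.exists_degree_le_mul_sum_le (G : SimpleGraph V) (A : Set V)
    (hA : ∀ u v, G.Adj u v → (u ∈ A ↔ v ∉ A)) {n k : ℕ} (hn : ∀ v, G.degree v ≤ n) (hk : k ≤ n) :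
    ∃ H ≤ G, (∀ v, H.degree v ≤ k) ∧ k * ∑ v, G.degree v ≤ n * ∑ v, H.degree v := by
  obtain ⟨E, hE, hI⟩ := G.exists_matchings A hA hn
  obtain ⟨I, hIk, h⟩ := exists_card_eq_mul_sum_le (fun i => #{v | E i v}) hk
  obtain ⟨H, hH, hdeg⟩ := hI I
  refine ⟨H, hH, fun v => ?_, ?_⟩
  · rw [hdeg, ← hIk]
    exact card_filter_le _ _
  · have h1 : ∀ J : Finset (Fin n), ∑ v, #{i ∈ J | E i v} = ∑ i ∈ J, #{v | E i v} := by
      intro J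
      simp only [card_filter]
      exact sum_comm
    rw [sum_congr rfl fun v _ => hE v, sum_congr rfl fun v _ => hdeg v, h1, h1]
    exact h

lemma SimpleGraph.exists_degree_eq_of_le (G : SimpleGraph V) (A : Set V)
    (hA : ∀ u v, G.Adj u v → (u ∈ A ↔ v ∉ A)) {n k : ℕ} (hk1 : 1 ≤ k) (hk : k ≤ n)
    (hn : ∀ v, G.degree v = 0 ∨ G.degree v = n) (hne : ∃ u v, G.Adj u v) :
    ∃ H ≤ G, (∀ v, H.degree v = 0 ∨ H.degree v = k) ∧ ∃ u v, H.Adj u v := by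
  obtain ⟨E, hE, hI⟩ := G.exists_matchings A hA (k := n) fun v => by
    rcases hn v with h | h <;> omega
  obtain ⟨I, -, hIk⟩ := exists_subset_card_eq (s := (univ : Finset (Fin n))) (n := k) (by simpa)
  obtain ⟨H, hH, hdeg⟩ := hI I
  have hfull : ∀ v, G.degree v = n → H.degree v = k := by
    intro v h
    have h1 : #{i | E i v} = #(univ : Finset (Fin n)) := by rw [← hE, h]; simp
    have h2 := card_filter_eq_iff.1 h1
    rw [hdeg, ← hIk]
    exact card_filter_eq_iff.2 fun i _ => h2 i (mem_univ i)
  refine ⟨H, hH, fun v => ?_, ?_⟩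
  · rcases hn v with h | h
    · exact Or.inl (Nat.le_zero.1 ((SimpleGraph.degree_mono hH v).trans h.le))
    · exact Or.inr (hfull v h)
  · obtain ⟨u, v, huv⟩ := hne
    have h1 := (G.degree_pos_iff_exists_adj u).2 ⟨v, huv⟩
    have h2 := hfull u ((hn u).resolve_left h1.ne')
    exact ⟨u, (H.degree_pos_iff_exists_adj u).1 (by omega)⟩

end Layers

/-! ### Regular subgraphs of prime degree by Chevalley–Warning. -/

section Prime

variable {V : Type*} [Fintype V]

/-- The theorem of Alon, Friedland and Kalai for prime moduli. -/
lemma SimpleGraph.exists_degree_eq_prime (G : SimpleGraph V) (S : Finset V) {p : ℕ}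
    (hp : p.Prime) (hS : ∀ v, v ∉ S → G.degree v = 0) (hdeg : ∀ v, G.degree v < 2 * p)
    (hsum : 2 * ((p - 1) * #S) < ∑ v, G.degree v) :
    ∃ H ≤ G, (∀ v, H.degree v = 0 ∨ H.degree v = p) ∧ ∃ u v, H.Adj u v := by
  have := Fact.mk hp
  -- By Fermat, `f v` evaluates to the number of edges at v in the support of the assignment, mod p.
  -- A non-zero common root therefore selects edges with all degrees divisible by p, hence 0 or p.
  set f : V → MvPolynomial G.edgeSet (ZMod p) :=
    fun v => ∑ e : G.edgeSet with v ∈ e.1, MvPolynomial.X e ^ (p - 1) with hf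
  have htd : ∀ v, (f v).totalDegree ≤ p - 1 := by
    intro v
    refine MvPolynomial.totalDegree_finsetSum_le fun e _ => ?_
    exact (MvPolynomial.totalDegree_pow _ _).trans (by rw [MvPolynomial.totalDegree_X, mul_one])
  have hlt : ∑ v ∈ S, (f v).totalDegree < Fintype.card G.edgeSet := by
    rw [SimpleGraph.sum_degrees_eq_twice_card_edges] at hsum
    have h1 : #G.edgeFinset = Fintype.card G.edgeSet := by
      rw [SimpleGraph.edgeFinset, Set.toFinset_card]
    have h2 : ∑ v ∈ S, (f v).totalDegree ≤ #S * (p - 1) := by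
      simpa using sum_le_card_nsmul S _ _ fun v _ => htd v
    rw [← h1]
    rw [mul_comm] at h2
    omega
  set Z := {x : G.edgeSet → ZMod p // ∀ v ∈ S, MvPolynomial.eval x (f v) = 0}
  have hdvd : p ∣ Fintype.card Z := by
    convert char_dvd_card_solutions_of_sum_lt p hlt
  have hp1 : p - 1 ≠ 0 := by have := hp.two_le; omega
  have hz : ∀ v ∈ S, MvPolynomial.eval (0 : G.edgeSet → ZMod p) (f v) = 0 := by
    intro v _
    simp [hf, hp1]
  obtain ⟨⟨x, hx⟩, hx0⟩ : ∃ x : Z, x ≠ ⟨0, hz⟩ := by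
    have : Nontrivial Z := by
      rw [← Fintype.one_lt_card_iff_nontrivial]
      have : 0 < Fintype.card Z := Fintype.card_pos_iff.2 ⟨⟨0, hz⟩⟩
      exact hp.one_lt.trans_le (Nat.le_of_dvd this hdvd)
    exact exists_ne _
  have hx0' : ∃ e, x e ≠ 0 := by
    by_contra! h
    exact hx0 (Subtype.ext (funext h))
  obtain ⟨H, hH⟩ : ∃ H : SimpleGraph V,
      H = SimpleGraph.fromEdgeSet {e | ∃ h : e ∈ G.edgeSet, x ⟨e, h⟩ ≠ 0} := ⟨_, rfl⟩
  have hHG : H ≤ G := by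
    intro u v h
    rw [hH, SimpleGraph.fromEdgeSet_adj] at h
    exact h.1.1
  have hHe : ∀ e, e ∈ H.edgeSet ↔ ∃ h : e ∈ G.edgeSet, x ⟨e, h⟩ ≠ 0 := by
    intro e
    rw [hH, SimpleGraph.edgeSet_fromEdgeSet]
    simp only [Set.mem_sdiff, Set.mem_ofPred_eq]
    exact ⟨fun h => h.1, fun h => ⟨h, G.not_isDiag_of_mem_edgeSet h.1⟩⟩
  have hHdeg : ∀ v, H.degree v = #{e : G.edgeSet | v ∈ e.1 ∧ x e ≠ 0} := by
    intro v
    rw [← SimpleGraph.card_incidenceFinset_eq_degree]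
    symm
    refine card_bij (fun e _ => e.1) ?_ ?_ ?_
    · intro e he
      rw [mem_filter] at he
      rw [SimpleGraph.mem_incidenceFinset]
      exact ⟨(hHe _).2 ⟨e.2, he.2.2⟩, he.2.1⟩
    · intro e _ e' _ h
      exact Subtype.ext h
    · intro e he
      rw [SimpleGraph.mem_incidenceFinset] at he
      obtain ⟨h1, h2⟩ := (hHe e).1 he.1
      exact ⟨⟨e, h1⟩, mem_filter.2 ⟨mem_univ _, he.2, h2⟩, rfl⟩
  refine ⟨H, hHG, fun v => ?_, ?_⟩
  · by_cases hv : v ∈ S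
    · have h1 := hx v hv
      have h2 : (H.degree v : ZMod p) = 0 := by
        rw [← h1, hHdeg, ← filter_filter, card_filter, hf]
        simp only [map_sum, map_pow, MvPolynomial.eval_X, Nat.cast_sum]
        refine sum_congr rfl fun e _ => ?_
        split_ifs with h
        · rw [ZMod.pow_card_sub_one_eq_one h, Nat.cast_one]
        · rw [not_not.1 h, zero_pow hp1, Nat.cast_zero]
      rw [ZMod.natCast_eq_zero_iff] at h2
      obtain ⟨c, hc⟩ := h2
      have h3 : p * c < p * 2 := by
        rw [← hc, mul_comm]; exact (SimpleGraph.degree_mono hHG v).trans_lt (hdeg v)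
      have h4 := Nat.lt_of_mul_lt_mul_left h3
      interval_cases c <;> omega
    · exact Or.inl (Nat.le_zero.1 ((SimpleGraph.degree_mono hHG v).trans (hS v hv).le))
  · obtain ⟨⟨e, he⟩, hxe⟩ := hx0'
    induction e with | _ u v =>
    exact ⟨u, v, (hHe s(u, v)).2 ⟨he, hxe⟩⟩

lemma SimpleGraph.hasRegularSubgraph_of_le {G H : SimpleGraph V} (hHG : H ≤ G) {r : ℕ}
    (hdeg : ∀ v, H.degree v = 0 ∨ H.degree v = r) (hne : ∃ u v, H.Adj u v) :
    G.HasRegularSubgraph r := by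
  obtain ⟨u₀, v₀, h₀⟩ := hne
  refine ⟨{ verts := H.support
            Adj := H.Adj
            adj_sub := fun h => hHG h
            edge_vert := fun h => ⟨_, h⟩
            symm := H.symm }, fun _ => inferInstance, ⟨u₀, v₀, h₀⟩, ?_⟩
  rintro ⟨v, u, hu⟩
  have h1 : H.degree v = r :=
    (hdeg v).resolve_left ((H.degree_pos_iff_exists_adj v).2 ⟨u, hu⟩).ne'
  rw [← h1, ← SimpleGraph.card_neighborFinset_eq_degree,
    ← SimpleGraph.card_neighborFinset_eq_degree]
  refine card_bij (fun x _ => x.1) ?_ ?_ ?_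
  · intro x hx
    rw [SimpleGraph.mem_neighborFinset] at hx ⊢
    exact hx
  · intro x _ y _ h
    exact Subtype.ext h
  · intro x hx
    rw [SimpleGraph.mem_neighborFinset] at hx
    exact ⟨⟨x, v, hx.symm⟩, by rw [SimpleGraph.mem_neighborFinset]; exact hx, rfl⟩

end Prime

/-! ### Part (i): from the product condition, and then from average degree, to regular subgraphs. -/

section UpperBound

lemma SimpleGraph.HasRegularSubgraph.mono {V : Type*} {G H : SimpleGraph V} (h : G ≤ H) {r : ℕ}
    (hG : G.HasRegularSubgraph r) : H.HasRegularSubgraph r := by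
  obtain ⟨K, hK, hne, hreg⟩ := hG
  exact ⟨{ verts := K.verts
           Adj := K.Adj
           adj_sub := fun h' => h (K.adj_sub h')
           edge_vert := K.edge_vert
           symm := K.symm }, hK, hne, hreg⟩

lemma SimpleGraph.exists_hasRegularSubgraph_of_mul_le : ∃ K : ℕ, 0 < K ∧
    ∀ {V : Type} [Fintype V] (G : SimpleGraph V) (A : Set V),
    (∀ u v, G.Adj u v → (u ∈ A ↔ v ∉ A)) → ∀ {L : ℝ} {r : ℕ}, 1 ≤ r →
    (∀ v, (G.degree v : ℝ) ≤ L) →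
    (∀ u v, G.Adj u v → ((K * r : ℕ) : ℝ) * L ≤ G.degree u * G.degree v) →
    (∃ u v, G.Adj u v) → G.HasRegularSubgraph r := by
  obtain ⟨c, hc, hreg⟩ := SimpleGraph.exists_almost_regular
  set K := ⌈8 * c + 16⌉₊ with hK
  have hKc : 8 * c + 16 ≤ K := Nat.le_ceil _
  refine ⟨K, Nat.cast_pos.1 (lt_of_lt_of_le (by positivity) hKc), ?_⟩
  intro V _ G A hA L r hr hL hG hne
  have hr1 : (1 : ℝ) ≤ r := by exact_mod_cast hr
  have hD : (8 * c + 16) * r ≤ ((K * r : ℕ) : ℝ) := by push_cast; gcongr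
  obtain ⟨H, hHG, S, L', hS, hL', hH0, hHL, hHsum⟩ := hreg G (D := ((K * r : ℕ) : ℝ))
    (by nlinarith) hL hG hne
  obtain ⟨p, hp, hrp, hp2⟩ := Nat.exists_prime_lt_and_le_two_mul r (by omega)
  set n := ⌊L'⌋₊ with hn
  have hL'0 : 0 ≤ L' := by nlinarith
  have hnL : (n : ℝ) ≤ L' := Nat.floor_le hL'0
  have hnL' : L' < n + 1 := Nat.lt_floor_add_one L'
  have hHn : ∀ v, H.degree v ≤ n := fun v => Nat.le_floor (hHL v)
  have hk4 : ((2 * p - 1 : ℕ) : ℝ) ≤ 4 * r := by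
    have : 2 * p - 1 ≤ 4 * r := by omega
    exact_mod_cast this
  have hnc : ((2 * p - 1 : ℕ) : ℝ) * c + 1 < n := by nlinarith
  have hkn : 2 * p - 1 ≤ n := by
    have : ((2 * p - 1 : ℕ) : ℝ) ≤ n := by nlinarith
    exact_mod_cast this
  have hAH : ∀ u v, H.Adj u v → (u ∈ A ↔ v ∉ A) := fun u v h => hA u v (hHG h)
  obtain ⟨H₂, hH₂, hdeg₂, hsum₂⟩ := H.exists_degree_le_mul_sum_le A hAH hHn hkn
  have hS0 : (0 : ℝ) < #S := Nat.cast_pos.2 hS.card_pos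
  have hsum : 2 * ((p - 1) * #S) < ∑ v, H₂.degree v := by
    have h1 : ∑ v ∈ S, (H.degree v : ℝ) = ∑ v, (H.degree v : ℝ) :=
      sum_subset (subset_univ S) fun v _ hv => by rw [hH0 v hv, Nat.cast_zero]
    rw [h1] at hHsum
    have h2 : ((2 * p - 1 : ℕ) : ℝ) * ∑ v, (H.degree v : ℝ) ≤ n * ∑ v, (H₂.degree v : ℝ) := by
      exact_mod_cast hsum₂
    have h3 : ((2 * p - 1 : ℕ) : ℝ) = 2 * ((p - 1 : ℕ) : ℝ) + 1 := by
      have : 2 * p - 1 = 2 * (p - 1) + 1 := by have := hp.two_le; omega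
      rw [this]; push_cast; ring
    set k := ((p - 1 : ℕ) : ℝ) with hk
    have hk0 : 0 ≤ k := Nat.cast_nonneg _
    rw [h3] at h2 hnc
    have h4 : (2 * k + 1) * ((L' - c) * #S) ≤ (2 * k + 1) * ∑ v, (H.degree v : ℝ) := by gcongr
    -- With k = p - 1 this needs (2k + 1)(n - c) > 2kn, that is n > (2k + 1)c, which the choice of
    -- `K` ensures.
    have h5 : (n : ℝ) * (2 * (k * #S)) < n * ∑ v, (H₂.degree v : ℝ) := by
      have : (2 * k + 1) * ((n - c) * #S) ≤ (2 * k + 1) * ((L' - c) * #S) := by gcongr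
      nlinarith
    have h6 := lt_of_mul_lt_mul_left h5 (Nat.cast_nonneg n)
    rw [hk] at h6
    exact_mod_cast h6
  obtain ⟨H₃, hH₃, hdeg₃, hne₃⟩ := H₂.exists_degree_eq_prime S hp
    (fun v hv => Nat.le_zero.1 ((SimpleGraph.degree_mono hH₂ v).trans (hH0 v hv).le))
    (fun v => by have := hdeg₂ v; have := hp.two_le; omega) hsum
  obtain ⟨H₄, hH₄, hdeg₄, hne₄⟩ := H₃.exists_degree_eq_of_le A
    (fun u v h => hAH u v (hH₂ (hH₃ h))) hr hrp.le hdeg₃ hne₃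
  exact SimpleGraph.hasRegularSubgraph_of_le (hH₄.trans (hH₃.trans (hH₂.trans hHG))) hdeg₄ hne₄

variable {V : Type*} [Fintype V]

/-- Delete edges one at a time, charging each to an end u with degree at most `f u`; every deletion
lowers the term of u in the sum of minima. -/
lemma SimpleGraph.sum_degree_le_sum_min (G : SimpleGraph V) (f : V → ℕ)
    (h : ∀ H ≤ G, (∃ u v, H.Adj u v) → ∃ u v, H.Adj u v ∧ H.degree u ≤ f u) :
    ∑ v, G.degree v ≤ 2 * ∑ v, min (G.degree v) (f v) := by
  induction hn : ∑ v, G.degree v using Nat.strong_induction_on generalizing G with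
  | _ n ih =>
    by_cases hne : ∃ u v, G.Adj u v
    · obtain ⟨u, v, huv, hu⟩ := h G le_rfl hne
      obtain ⟨H, hH, hnot, hsum⟩ := G.exists_delete_edge huv
      have h1 := ih _ (by omega) H (fun H' hH' => h H' (hH'.trans hH)) rfl
      have h2 : ∑ v, min (H.degree v) (f v) < ∑ v, min (G.degree v) (f v) := by
        refine sum_lt_sum (fun x _ => min_le_min_right _ (SimpleGraph.degree_mono hH x))
          ⟨u, mem_univ _, ?_⟩
        have := SimpleGraph.degree_lt_of_le hH huv hnot
        rw [min_eq_left hu]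
        exact (min_le_left _ _).trans_lt this
      omega
    · have : ∑ v, G.degree v = 0 := by
        refine sum_eq_zero fun v _ => ?_
        by_contra hv
        exact hne ⟨v, (G.degree_pos_iff_exists_adj v).1 (Nat.pos_of_ne_zero hv)⟩
      omega

lemma SimpleGraph.exists_lt_degree (G : SimpleGraph V) (f : V → ℕ)
    (h : 2 * ∑ v, f v < ∑ v, G.degree v) :
    ∃ H ≤ G, (∃ u v, H.Adj u v) ∧ ∀ u v, H.Adj u v → f u < H.degree u := by
  by_contra! hc
  have h1 := G.sum_degree_le_sum_min f hc
  have h2 : ∑ v, min (G.degree v) (f v) ≤ ∑ v, f v := sum_le_sum fun v _ => min_le_right _ _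
  omega

/-- The edges of `G` whose larger end degree is in `[2 ^ i, 2 ^ (i + 1))`. -/
noncomputable def SimpleGraph.degreeLevel (G : SimpleGraph V) (i : ℕ) : SimpleGraph V where
  Adj u v := G.Adj u v ∧ Nat.log 2 (max (G.degree u) (G.degree v)) = i
  symm := ⟨fun u v h => ⟨h.1.symm, by rw [max_comm]; exact h.2⟩⟩
  loopless := ⟨fun v h => G.loopless.irrefl v h.1⟩

lemma SimpleGraph.degreeLevel_le (G : SimpleGraph V) (i : ℕ) : G.degreeLevel i ≤ G :=
  fun _ _ h => h.1

lemma SimpleGraph.sum_degree_degreeLevel (G : SimpleGraph V) (v : V) :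
    ∑ i ∈ range (Nat.log 2 (Fintype.card V) + 1), (G.degreeLevel i).degree v = G.degree v := by
  rw [← SimpleGraph.card_neighborFinset_eq_degree, card_eq_sum_card_fiberwise
    (f := fun u => Nat.log 2 (max (G.degree v) (G.degree u)))
    (t := range (Nat.log 2 (Fintype.card V) + 1))]
  · refine sum_congr rfl fun i _ => ?_
    rw [← SimpleGraph.card_neighborFinset_eq_degree]
    congr 1
    ext u
    rw [mem_filter, SimpleGraph.mem_neighborFinset, SimpleGraph.mem_neighborFinset]
    rfl
  · intro u _
    rw [mem_coe, mem_range, Nat.lt_succ_iff]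
    exact Nat.log_mono_right (max_le (G.degree_lt_card_verts v).le (G.degree_lt_card_verts u).le)

/-- If `G` has large average degree, it has a subgraph in which the product of the degrees of
adjacent vertices is at least `D` times a bound on the degrees. -/
lemma SimpleGraph.exists_mul_le_degree_mul_degree (G : SimpleGraph V) {D i₀ : ℕ}
    (hi₀ : i₀ ≤ Nat.log 2 (Fintype.card V) + 1)
    (h : 4 * (2 ^ i₀ * Fintype.card V) +
      128 * ((Nat.log 2 (Fintype.card V) + 1 - i₀) * (D * Fintype.card V)) <
      3 * ∑ v, G.degree v) :
    ∃ H ≤ G, ∃ L : ℝ, (∀ v, (H.degree v : ℝ) ≤ L) ∧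
      (∀ u v, H.Adj u v → (D : ℝ) * L ≤ H.degree u * H.degree v) ∧ ∃ u v, H.Adj u v := by
  set N := Nat.log 2 (Fintype.card V) + 1 with hN
  -- The threshold 16D is paid at every level, but 2^i/8 only at the level of the vertex's own
  -- degree, where it is at most an eighth of that degree. The two thresholds multiply to D ·
  -- 2^(i+1).
  set f : ℕ → V → ℕ := fun i v => 16 * D + if Nat.log 2 (G.degree v) = i then 2 ^ i / 8 else 0
    with hf
  obtain ⟨i, hi⟩ : ∃ i, 2 * ∑ v, f i v < ∑ v, (G.degreeLevel i).degree v := by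
    by_contra! hc
    have h1 : ∑ v, G.degree v = ∑ i ∈ range N, ∑ v, (G.degreeLevel i).degree v := by
      rw [sum_comm]
      exact sum_congr rfl fun v _ => (G.sum_degree_degreeLevel v).symm
    have hlow : ∑ i ∈ range i₀, ∑ v, (G.degreeLevel i).degree v ≤ 2 ^ i₀ * Fintype.card V := by
      rw [sum_comm, mul_comm, ← smul_eq_mul, ← card_univ]
      refine sum_le_card_nsmul _ _ _ fun v _ => ?_
      rcases lt_or_ge (G.degree v) (2 ^ i₀) with hv | hv
      · refine le_trans ?_ hv.le
        rw [← G.sum_degree_degreeLevel v]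
        exact sum_le_sum_of_subset (range_subset_range.2 hi₀)
      · rw [sum_eq_zero]
        · exact Nat.zero_le _
        · intro i hi
          rw [mem_range] at hi
          by_contra hne
          obtain ⟨u, hu⟩ := ((G.degreeLevel i).degree_pos_iff_exists_adj v).1
            (Nat.pos_of_ne_zero hne)
          have h3 : i₀ ≤ Nat.log 2 (max (G.degree v) (G.degree u)) :=
            Nat.le_log_of_pow_le (by norm_num) (hv.trans (le_max_left _ _))
          rw [hu.2] at h3
          omega
    have hhigh : ∑ i ∈ Ico i₀ N, ∑ v, (G.degreeLevel i).degree v ≤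
        ∑ i ∈ Ico i₀ N, 2 * ∑ v, f i v := sum_le_sum fun i _ => hc i
    have hfsum : 4 * ∑ i ∈ Ico i₀ N, 2 * ∑ v, f i v ≤
        128 * ((N - i₀) * (D * Fintype.card V)) + ∑ v, G.degree v := by
      have h2 : ∑ i ∈ Ico i₀ N, ∑ v, f i v = (N - i₀) * (D * Fintype.card V) * 16 +
          ∑ v, ∑ i ∈ Ico i₀ N, if Nat.log 2 (G.degree v) = i then 2 ^ i / 8 else 0 := by
        simp only [hf, sum_add_distrib]
        rw [sum_comm (s := Ico i₀ N) (t := univ)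
          (f := fun i v => if Nat.log 2 (G.degree v) = i then 2 ^ i / 8 else 0)]
        congr 1
        simp only [sum_const, smul_eq_mul, card_univ, Nat.card_Ico]
        ring
      have h3 : ∑ v, ∑ i ∈ Ico i₀ N, (if Nat.log 2 (G.degree v) = i then 2 ^ i / 8 else 0) * 8 ≤
          ∑ v, G.degree v := by
        refine sum_le_sum fun v _ => ?_
        rw [← sum_mul, sum_ite_eq]
        split_ifs
        · rcases Nat.eq_zero_or_pos (G.degree v) with h0 | h0
          · simp [h0]
          · refine (Nat.div_mul_le_self _ _).trans ?_
            exact Nat.pow_log_le_self 2 h0.ne'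
        · simp
      simp only [← sum_mul] at h3
      rw [← mul_sum, h2]
      omega
    have h4 := sum_range_add_sum_Ico (fun i => ∑ v, (G.degreeLevel i).degree v) hi₀
    omega
  obtain ⟨H, hH, hne, hdeg⟩ := (G.degreeLevel i).exists_lt_degree (f i) hi
  refine ⟨H, hH.trans (G.degreeLevel_le i), 2 ^ (i + 1), fun v => ?_, fun u v huv => ?_, hne⟩
  · rcases Nat.eq_zero_or_pos (H.degree v) with h0 | h0
    · rw [h0, Nat.cast_zero]; positivity
    · obtain ⟨u, hu⟩ := (H.degree_pos_iff_exists_adj v).1 h0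
      have h1 := (hH hu).2
      have h2 := Nat.lt_pow_succ_log_self (b := 2) (by norm_num) (max (G.degree v) (G.degree u))
      rw [h1] at h2
      have h3 := SimpleGraph.degree_mono (hH.trans (G.degreeLevel_le i)) v
      have h4 := (h3.trans (le_max_left _ _)).trans h2.le
      exact_mod_cast h4
  · have key : ∀ u v, f i u < H.degree u → f i v < H.degree v → Nat.log 2 (G.degree u) = i →
        (D : ℝ) * 2 ^ (i + 1) ≤ H.degree u * H.degree v := by
      intro u v hu hv hui
      simp only [hf, hui, if_true] at hu
      have h1 : 2 ^ i ≤ 8 * H.degree u := by omega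
      have h2 : 16 * D ≤ H.degree v := by simp only [hf] at hv; omega
      have h3 : 2 ^ i * (16 * D) ≤ 8 * H.degree u * H.degree v := Nat.mul_le_mul h1 h2
      have h4 : D * 2 ^ (i + 1) ≤ H.degree u * H.degree v := by
        rw [pow_succ]; nlinarith
      exact_mod_cast h4
    have h1 := (hH huv).2
    rcases max_choice (G.degree u) (G.degree v) with h2 | h2 <;> rw [h2] at h1
    · exact key u v (hdeg u v huv) (hdeg v u huv.symm) h1
    · rw [mul_comm (H.degree u : ℝ)]
      exact key v u (hdeg v u huv.symm) (hdeg u v huv) h1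

/-- A uniformly random vertex set cuts each edge with probability 1/2. -/
lemma SimpleGraph.exists_bipartite (G : SimpleGraph V) : ∃ H ≤ G, ∃ A : Set V,
    (∀ u v, H.Adj u v → (u ∈ A ↔ v ∉ A)) ∧ ∑ v, G.degree v ≤ 2 * ∑ v, H.degree v := by
  set f : Finset V → ℝ := fun ω => ∑ v, ∑ u ∈ G.neighborFinset v,
    ((if {v} ⊆ ω then 1 else 0) + (if {u} ⊆ ω then 1 else 0) - 2 * if {v, u} ⊆ ω then 1 else 0)
    with hf
  have h1 : (∑ v, (G.degree v : ℝ)) / 2 ≤ subsetExpect (fun _ => 1 / 2) f := by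
    rw [hf, subsetExpect_sum, sum_div]
    refine sum_le_sum fun v _ => ?_
    rw [subsetExpect_sum, ← SimpleGraph.card_neighborFinset_eq_degree, div_eq_mul_inv,
      ← nsmul_eq_mul, ← sum_const]
    refine sum_le_sum fun u hu => ?_
    rw [SimpleGraph.mem_neighborFinset] at hu
    rw [subsetExpect_sub, subsetExpect_add, subsetExpect_mul_left, subsetExpect_subset,
      subsetExpect_subset, subsetExpect_subset, prod_pair hu.ne]
    norm_num
  obtain ⟨ω, hω⟩ := exists_le_of_le_subsetExpect (by norm_num) (by norm_num) h1
  obtain ⟨H, hH⟩ : ∃ H : SimpleGraph V, ∀ u v, H.Adj u v ↔ G.Adj u v ∧ (u ∈ ω ↔ v ∉ ω) :=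
    ⟨{ Adj := fun u v => G.Adj u v ∧ (u ∈ ω ↔ v ∉ ω)
       symm := ⟨fun u v h => ⟨h.1.symm, by tauto⟩⟩
       loopless := ⟨fun v h => G.loopless.irrefl v h.1⟩ }, fun _ _ => Iff.rfl⟩
  refine ⟨H, fun u v h => ((hH u v).1 h).1, ω, fun u v h => ((hH u v).1 h).2, ?_⟩
  have h2 : f ω = ∑ v, (H.degree v : ℝ) := by
    rw [hf]
    refine sum_congr rfl fun v _ => ?_
    have h3 : H.neighborFinset v = (G.neighborFinset v).filter fun u => (v ∈ ω ↔ u ∉ ω) := by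
      ext u
      rw [mem_filter, SimpleGraph.mem_neighborFinset, SimpleGraph.mem_neighborFinset, hH]
    rw [← SimpleGraph.card_neighborFinset_eq_degree, h3, card_filter, Nat.cast_sum]
    refine sum_congr rfl fun u _ => ?_
    by_cases hu : u ∈ ω <;> by_cases hv : v ∈ ω <;>
      norm_num [hu, hv, insert_subset_iff]
  rw [h2] at hω
  have h3 : ∑ v, (G.degree v : ℝ) ≤ 2 * ∑ v, (H.degree v : ℝ) := by linarith
  exact_mod_cast h3

theorem exists_hasRegularSubgraph_of_avgDegree : ∃ C : ℝ, 0 < C ∧ ∀ r n : ℕ, 1 ≤ r →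
    (r : ℝ) ≤ (n : ℝ) / 2 → ∀ G : SimpleGraph (Fin n),
      C * (r : ℝ) * Real.logb 2 ((n : ℝ) / (r : ℝ)) ≤ G.avgDegree → G.HasRegularSubgraph r := by
  obtain ⟨K, hK, hreg⟩ := SimpleGraph.exists_hasRegularSubgraph_of_mul_le
  have hK1 : (1 : ℝ) ≤ K := by exact_mod_cast hK
  refine ⟨1000 * K, by positivity, ?_⟩
  intro r n hr hrn G hG
  have hr1 : (1 : ℝ) ≤ r := by exact_mod_cast hr
  have hn2 : (2 : ℝ) ≤ n := by linarith
  have hn0 : (0 : ℝ) < n := by linarith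
  set l := Real.logb 2 ((n : ℝ) / r) with hl
  have hl1 : 1 ≤ l := by
    rw [hl, Real.le_logb_iff_rpow_le (by norm_num) (by positivity), Real.rpow_one,
      le_div_iff₀ (by positivity)]
    linarith
  obtain ⟨B, hB, A, hA, hBsum⟩ := G.exists_bipartite
  set s := ∑ v, B.degree v with hs
  have hsn : 500 * K * r * l * n ≤ s := by
    have h1 : G.avgDegree * n ≤ 2 * (s : ℝ) := by
      have h2 : G.avgDegree = (∑ v, (G.degree v : ℝ)) / n := by
        simp [SimpleGraph.avgDegree]
      rw [h2, div_mul_cancel₀ _ hn0.ne']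
      exact_mod_cast hBsum
    have h2 := mul_le_mul_of_nonneg_right hG hn0.le
    linarith
  have hKrl : (1 : ℝ) ≤ K * r * l :=
    one_le_mul_of_one_le_of_one_le (one_le_mul_of_one_le_of_one_le hK1 hr1) hl1
  set d : ℝ := s / n with hd
  have hd500 : 500 * (K * r * l) ≤ d := by rw [hd, le_div_iff₀ hn0]; linarith
  have hsd : d * n = s := by rw [hd]; field_simp
  set i₀ := Nat.log 2 ⌊d / 4⌋₊ with hi₀
  have hfl : ⌊d / 4⌋₊ ≠ 0 := by
    have : 1 ≤ ⌊d / 4⌋₊ := Nat.le_floor (by push_cast; linarith)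
    omega
  have h2i₀ : (2 : ℝ) ^ i₀ ≤ d / 4 := by
    have h1 := Nat.pow_log_le_self 2 hfl
    have h2 : ((2 ^ i₀ : ℕ) : ℝ) ≤ ⌊d / 4⌋₊ := by exact_mod_cast h1
    push_cast at h2
    exact h2.trans (Nat.floor_le (by linarith))
  have hi₀d : d / 8 < (2 : ℝ) ^ i₀ := by
    have h1 := Nat.lt_pow_succ_log_self (b := 2) (by norm_num) ⌊d / 4⌋₊
    have h2 : ((⌊d / 4⌋₊ + 1 : ℕ) : ℝ) ≤ 2 ^ (i₀ + 1) := by exact_mod_cast h1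
    have h3 := Nat.lt_floor_add_one (d / 4)
    push_cast at h2
    rw [pow_succ] at h2
    linarith
  have hdn : d ≤ n := by
    have h1 : s ≤ n * n := by
      rw [hs]
      calc ∑ v, B.degree v ≤ ∑ _v : Fin n, n := sum_le_sum fun v _ => by
            simpa using (B.degree_lt_card_verts v).le
        _ = n * n := by simp
    rw [hd, div_le_iff₀ hn0]
    exact_mod_cast h1
  have hi₀N : i₀ ≤ Nat.log 2 n := Nat.log_mono_right (Nat.floor_le_of_le (by linarith))
  -- As 2^i₀ > d/8 ≥ r, the levels above i₀ span a ratio of at most n/r. This gives log(n/r) in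
  -- place of log n.
  have hN : ((Nat.log 2 n + 1 - i₀ : ℕ) : ℝ) ≤ 5 * l := by
    have h1 : (2 : ℝ) ^ Nat.log 2 n ≤ n := by
      exact_mod_cast Nat.pow_log_le_self 2 (by rintro rfl; norm_num at hn2)
    set j := Nat.log 2 n - i₀ with hj
    have h2 : (2 : ℝ) ^ j * 2 ^ i₀ ≤ n := by rw [← pow_add, hj, Nat.sub_add_cancel hi₀N]; exact h1
    have h3 : (2 : ℝ) ^ j ≤ n / r := by
      rw [le_div_iff₀ (by positivity)]
      refine le_trans ?_ h2
      gcongr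
      have : (r : ℝ) ≤ K * r * l := by
        calc (r : ℝ) = 1 * r * 1 := by ring
          _ ≤ K * r * l := by gcongr
      linarith
    have h4 : (j : ℝ) ≤ l := by
      rw [hl, Real.le_logb_iff_rpow_le (by norm_num) (by positivity), Real.rpow_natCast]
      exact h3
    have h5 : Nat.log 2 n + 1 - i₀ = j + 1 := by omega
    rw [h5]
    push_cast
    linarith
  obtain ⟨H, hH, L, hHL, hHG, hne⟩ := B.exists_mul_le_degree_mul_degree (D := K * r) (i₀ := i₀)
    (by simpa using hi₀N.trans (Nat.le_succ _)) (by
      rw [Fintype.card_fin]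
      have h1 : (4 : ℝ) * (2 ^ i₀ * n) + 128 * ((Nat.log 2 n + 1 - i₀ : ℕ) * (K * r * n)) <
          3 * s := by
        calc (4 : ℝ) * (2 ^ i₀ * n) + 128 * ((Nat.log 2 n + 1 - i₀ : ℕ) * (K * r * n)) ≤
            4 * (d / 4 * n) + 128 * (5 * l * (K * r * n)) := by gcongr
          _ = d * n + 640 * (K * r * l) * n := by ring
          _ < 3 * (d * n) := by nlinarith
          _ = 3 * s := by rw [hsd]
      exact_mod_cast h1)
  exact SimpleGraph.HasRegularSubgraph.mono (hH.trans hB)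
    (hreg H A (fun u v h => hA u v (hH h)) hr hHL hHG hne)

end UpperBound

/-! ### Part (ii): graphs without regular subgraphs. -/

section LowerBound

lemma SimpleGraph.HasRegularSubgraph.exists_le {V : Type*} [Fintype V] {G : SimpleGraph V} {r : ℕ}
    (hr : 1 ≤ r) (h : G.HasRegularSubgraph r) :
    ∃ H ≤ G, (∀ v, H.degree v = 0 ∨ H.degree v = r) ∧ ∃ u v, H.Adj u v := by
  obtain ⟨K, hK, ⟨v₀, hv₀⟩, hreg⟩ := h
  obtain ⟨H, hH⟩ : ∃ H : SimpleGraph V, ∀ u v, H.Adj u v ↔ K.Adj u v :=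
    ⟨K.spanningCoe, fun _ _ => Iff.rfl⟩
  have hdeg : ∀ v ∈ K.verts, H.degree v = r := by
    intro v hv
    rw [← hreg ⟨v, hv⟩, ← SimpleGraph.card_neighborFinset_eq_degree,
      ← SimpleGraph.card_neighborFinset_eq_degree]
    symm
    refine card_bij (fun x _ => x.1) ?_ ?_ ?_
    · intro x hx
      rw [SimpleGraph.mem_neighborFinset] at hx ⊢
      exact (hH _ _).2 hx
    · intro x _ y _ h
      exact Subtype.ext h
    · intro x hx
      rw [SimpleGraph.mem_neighborFinset, hH] at hx
      exact ⟨⟨x, K.edge_vert hx.symm⟩, by rw [SimpleGraph.mem_neighborFinset]; exact hx, rfl⟩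
  refine ⟨H, fun u v h => K.adj_sub ((hH u v).1 h), fun v => ?_, ?_⟩
  · by_cases hv : v ∈ K.verts
    · exact Or.inr (hdeg v hv)
    · left
      by_contra h0
      obtain ⟨u, hu⟩ := (H.degree_pos_iff_exists_adj v).1 (Nat.pos_of_ne_zero h0)
      exact hv (K.edge_vert ((hH v u).1 hu))
  · have h1 := hdeg v₀ hv₀
    exact ⟨v₀, (H.degree_pos_iff_exists_adj v₀).1 (by omega)⟩

/-- In the complete bipartite graph with a side of size r - 1, each edge has an end of degree r - 1,
which cannot lie in an r-regular subgraph. -/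
lemma exists_not_hasRegularSubgraph_complete {r n : ℕ} (hr : 2 ≤ r) (hrn : 2 * r ≤ n) :
    ∃ G : SimpleGraph (Fin n), (r : ℝ) / 4 ≤ G.avgDegree ∧ ¬ G.HasRegularSubgraph r := by
  obtain ⟨G, hG⟩ : ∃ G : SimpleGraph (Fin n), ∀ u v, G.Adj u v ↔
      (u.1 < r - 1 ∧ r - 1 ≤ v.1) ∨ (v.1 < r - 1 ∧ r - 1 ≤ u.1) :=
    ⟨{ Adj := fun u v => (u.1 < r - 1 ∧ r - 1 ≤ v.1) ∨ (v.1 < r - 1 ∧ r - 1 ≤ u.1)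
       symm := ⟨fun u v h => h.symm⟩
       loopless := ⟨fun v h => by omega⟩ }, fun _ _ => Iff.rfl⟩
  have hcard : #{u : Fin n | u.1 < r - 1} = r - 1 := by
    rw [Fin.card_filter_val_lt]; omega
  have hdeg : ∀ v : Fin n, r - 1 ≤ v.1 → G.degree v = r - 1 := by
    intro v hv
    rw [← SimpleGraph.card_neighborFinset_eq_degree, ← hcard]
    congr 1
    ext u
    rw [SimpleGraph.mem_neighborFinset, hG, mem_filter]
    simp only [mem_univ, true_and]
    omega
  refine ⟨G, ?_, fun h => ?_⟩
  · have h1 : (n - (r - 1)) * (r - 1) ≤ ∑ v, G.degree v := by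
      have h2 : #{v : Fin n | ¬ v.1 < r - 1} = n - (r - 1) := by
        have := card_filter_add_card_filter_not (s := (univ : Finset (Fin n)))
          (fun u => u.1 < r - 1)
        rw [card_univ, Fintype.card_fin] at this
        omega
      rw [← h2, ← smul_eq_mul]
      refine (card_nsmul_le_sum _ (fun v => G.degree v) _ fun v hv => ?_).trans
        (sum_le_sum_of_subset (subset_univ _))
      rw [mem_filter] at hv
      exact (hdeg v (by omega)).ge
    have h3 : n * r ≤ 4 * ∑ v, G.degree v := by
      have h4 : n ≤ 2 * (n - (r - 1)) := by omega
      have h5 : r ≤ 2 * (r - 1) := by omega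
      nlinarith [Nat.mul_le_mul h4 h5]
    have hn0 : (0 : ℝ) < n := by
      have : 0 < n := by omega
      exact_mod_cast this
    have h6 : (n : ℝ) * r ≤ 4 * ∑ v, (G.degree v : ℝ) := by exact_mod_cast h3
    have h7 : G.avgDegree = (∑ v, (G.degree v : ℝ)) / n := by simp [SimpleGraph.avgDegree]
    rw [h7, div_le_div_iff₀ (by norm_num) hn0]
    linarith
  · obtain ⟨H, hH, hHdeg, u, v, huv⟩ := h.exists_le (by omega)
    have key : ∀ u v : Fin n, H.Adj u v → ¬ r - 1 ≤ u.1 := by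
      intro u v huv hu
      have h1 := SimpleGraph.degree_mono hH u
      rw [hdeg u hu] at h1
      have h2 := (H.degree_pos_iff_exists_adj u).2 ⟨v, huv⟩
      rcases hHdeg u with h | h <;> omega
    rcases (hG u v).1 (hH huv) with h | h
    · exact key v u huv.symm h.2
    · exact key u v huv h.2

lemma subsetExpect_prod_sum {α β : Type*} [Fintype α] [Fintype β] (q : β → ℝ)
    (t : β → Finset (Finset α)) :
    subsetExpect (fun x : β × α => q x.1)
      (fun ω => ∏ b, ∑ R ∈ t b, if ∀ a ∈ R, (b, a) ∈ ω then (1 : ℝ) else 0) =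
      ∏ b, ∑ R ∈ t b, q b ^ #R := by
  simp only [prod_univ_sum]
  rw [subsetExpect_sum]
  refine sum_congr rfl fun g _ => ?_
  have h1 := subsetExpect_subset (fun x : β × α => q x.1) (univ.filter fun x => x.2 ∈ g x.1)
  have h2 : ∏ x : β × α with x.2 ∈ g x.1, q x.1 = ∏ b, q b ^ #(g b) := by
    rw [prod_filter, Fintype.prod_prod_type]
    refine prod_congr rfl fun b _ => ?_
    simp
  rw [← h2, ← h1]
  congr 1
  funext ω
  rw [Fintype.prod_ite_zero]
  congr 1
  · simp [subset_iff]
  · simp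

/-- The event that every vertex of `B` has at least `r` neighbours in `A`, counted with
multiplicity. -/
noncomputable def denseRows {n : ℕ} (r : ℕ) (A B : Finset (Fin n)) (ω : Finset (Fin n × Fin n)) :
    ℝ :=
  ∏ b ∈ B, ∑ R ∈ A.powersetCard r, if ∀ a ∈ R, (b, a) ∈ ω then (1 : ℝ) else 0

lemma denseRows_nonneg {n r : ℕ} (A B : Finset (Fin n)) (ω : Finset (Fin n × Fin n)) :
    0 ≤ denseRows r A B ω :=
  prod_nonneg fun _ _ => sum_nonneg fun _ _ => by split_ifs <;> norm_num

lemma one_le_denseRows {n r : ℕ} {A B : Finset (Fin n)} {ω : Finset (Fin n × Fin n)}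
    (h : ∀ b ∈ B, r ≤ #{a ∈ A | (b, a) ∈ ω}) : 1 ≤ denseRows r A B ω := by
  rw [← prod_const_one (s := B)]
  refine prod_le_prod (fun _ _ => zero_le_one) fun b hb => ?_
  obtain ⟨R, hR, hRr⟩ := exists_subset_card_eq (h b hb)
  refine le_trans (by rw [if_pos]; intro a ha; exact (mem_filter.1 (hR ha)).2)
    (single_le_sum (f := fun R => if ∀ a ∈ R, (b, a) ∈ ω then (1 : ℝ) else 0)
      (fun _ _ => by split_ifs <;> norm_num)
      (mem_powersetCard.2 ⟨hR.trans (filter_subset _ _), hRr⟩))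

/-- Distinct rows use disjoint coordinates. Counting r-sets in each row, instead of taking an
indicator, makes the expectation an exact product. -/
lemma subsetExpect_denseRows {n : ℕ} (r : ℕ) (A B : Finset (Fin n)) (q : Fin n → ℝ) :
    subsetExpect (fun x : Fin n × Fin n => q x.1) (denseRows r A B) =
      ∏ b ∈ B, ((#A).choose r : ℝ) * q b ^ r := by
  have h := subsetExpect_prod_sum (α := Fin n) q
    (fun b => if b ∈ B then A.powersetCard r else {∅})
  have h1 : (∏ b, ∑ R ∈ (if b ∈ B then A.powersetCard r else {∅}), q b ^ #R) =
      ∏ b ∈ B, ((#A).choose r : ℝ) * q b ^ r := by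
    rw [← prod_subset (subset_univ B)]
    · refine prod_congr rfl fun b hb => ?_
      rw [if_pos hb, sum_congr rfl (g := fun _ => q b ^ r) (by
        intro R hR
        rw [(mem_powersetCard.1 hR).2]), sum_const, card_powersetCard, nsmul_eq_mul]
    · intro b _ hb
      simp [hb]
  rw [← h1, ← h]
  congr 1
  funext ω
  rw [denseRows, ← prod_subset (subset_univ B)]
  · refine prod_congr rfl fun b hb => ?_
    rw [if_pos hb]
    refine sum_congr rfl fun R _ => ?_
    congr
  · intro b _ hb
    simp [hb]

lemma choose_mul_pow_le {s b r : ℕ} (hr : 1 ≤ r) (hb : r ≤ b) (hs : s ≤ 2 * b) {ε : ℝ}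
    (hε : 0 ≤ ε) : (s.choose r : ℝ) * (ε * r / b) ^ r ≤ (8 * ε) ^ r := by
  have hb0 : (0 : ℝ) < b := by
    have : 0 < b := by omega
    exact_mod_cast this
  have h1 : (s.choose r : ℝ) ≤ (2 * b : ℝ) ^ r / (r.factorial : ℝ) := by
    refine (Nat.choose_le_pow_div r s).trans ?_
    gcongr
    exact_mod_cast hs
  have h2 := Real.pow_div_factorial_le_exp (x := (r : ℝ)) (Nat.cast_nonneg r) r
  have h3 : Real.exp (r : ℝ) ≤ 4 ^ r := by
    rw [← Real.exp_one_pow]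
    gcongr
    linarith [Real.exp_one_lt_d9]
  calc (s.choose r : ℝ) * (ε * r / b) ^ r ≤
      (2 * b : ℝ) ^ r / (r.factorial : ℝ) * (ε * r / b) ^ r := by gcongr
    _ = (2 * ε) ^ r * ((r : ℝ) ^ r / (r.factorial : ℝ)) := by
        rw [div_pow, mul_pow, mul_pow, mul_pow]; field_simp
    _ ≤ (2 * ε) ^ r * 4 ^ r := by gcongr; exact h2.trans h3
    _ = (8 * ε) ^ r := by rw [← mul_pow]; ring_nf

/-- Since |A| ≤ 2|B|, the number of choices of A is absorbed by weighting with n^(-|A|) and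
n^(2|B|); the double sum then factors into two binomial expansions. -/
lemma sum_pow_card_le {n : ℕ} (hn : 2 ≤ n) {z : ℝ} (hz0 : 0 ≤ z) (hz : z ≤ (1 / n : ℝ) ^ 10) :
    ∑ A : Finset (Fin n), ∑ B : Finset (Fin n) with B.Nonempty ∧ #A ≤ 2 * #B, z ^ #B ≤
      6 * (1 / n : ℝ) ^ 7 := by
  have hn0 : (0 : ℝ) < n := by
    have : 0 < n := by omega
    exact_mod_cast this
  set x : ℝ := 1 / n with hx
  have hx0 : 0 < x := by positivity
  have hxn : n * x = 1 := by rw [hx]; field_simp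
  have hx1 : x ≤ 1 := by
    rw [hx, div_le_one hn0]
    have : 1 ≤ n := by omega
    exact_mod_cast this
  set y : ℝ := (n : ℝ) ^ 2 * z with hy
  have hy0 : 0 ≤ y := by positivity
  have hy8 : y ≤ x ^ 8 := by
    calc y ≤ (n : ℝ) ^ 2 * x ^ 10 := mul_le_mul_of_nonneg_left hz (by positivity)
      _ = (n * x) ^ 2 * x ^ 8 := by ring
      _ = x ^ 8 := by rw [hxn]; ring
  have h1 : ∀ A B : Finset (Fin n), #A ≤ 2 * #B → z ^ #B ≤ x ^ #A * y ^ #B := by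
    intro A B h
    have h2 : y ^ #B = (n : ℝ) ^ (2 * #B) * z ^ #B := by rw [hy, mul_pow, pow_mul]
    have h3 : 1 ≤ x ^ #A * (n : ℝ) ^ (2 * #B) := by
      have h4 : x ^ (2 * #B) ≤ x ^ #A := pow_le_pow_of_le_one hx0.le hx1 h
      calc (1 : ℝ) = x ^ (2 * #B) * (n : ℝ) ^ (2 * #B) := by rw [← mul_pow, mul_comm x, hxn, one_pow]
        _ ≤ _ := mul_le_mul_of_nonneg_right h4 (by positivity)
    rw [h2, ← mul_assoc]
    exact le_mul_of_one_le_left (by positivity) h3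
  have hpow : ∀ c : ℝ, ∑ A : Finset (Fin n), c ^ #A = (1 + c) ^ n := by
    intro c
    have := Fintype.sum_pow_mul_eq_add_pow (Fin n) c 1
    simp only [one_pow, mul_one, Fintype.card_fin] at this
    rw [this, add_comm]
  have hB : ∑ B : Finset (Fin n) with B.Nonempty, y ^ #B ≤ 2 * x ^ 7 := by
    have h2 := sum_filter_add_sum_filter_not (univ : Finset (Finset (Fin n)))
      (fun B => B.Nonempty) (fun B => y ^ #B)
    rw [hpow] at h2
    have h3 : ∑ B : Finset (Fin n) with ¬ B.Nonempty, y ^ #B = 1 := by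
      rw [sum_eq_single ∅]
      · simp
      · intro B hB hne
        simp [hne] at hB
      · simp
    have h4 : (1 + y) ^ n ≤ Real.exp (n * y) := by
      rw [Real.exp_nat_mul]
      gcongr
      linarith [Real.add_one_le_exp y]
    have h5 : n * y ≤ x ^ 7 := by
      calc n * y ≤ n * x ^ 8 := by gcongr
        _ = (n * x) * x ^ 7 := by ring
        _ = x ^ 7 := by rw [hxn, one_mul]
    have h7 : (n : ℝ) * y ≤ 1 := h5.trans (pow_le_one₀ hx0.le hx1)
    have h8 : 0 ≤ (n : ℝ) * y := by positivity
    have h6 := (abs_le.1 (Real.abs_exp_sub_one_sub_id_le (x := n * y) (by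
      rw [abs_of_nonneg h8]; exact h7))).2
    nlinarith
  have hA : ∑ A : Finset (Fin n), x ^ #A ≤ 3 := by
    rw [hpow]
    have h4 : (1 + x) ^ n ≤ Real.exp (n * x) := by
      rw [Real.exp_nat_mul]
      gcongr
      linarith [Real.add_one_le_exp x]
    rw [hxn] at h4
    linarith [Real.exp_one_lt_d9]
  calc ∑ A : Finset (Fin n), ∑ B : Finset (Fin n) with B.Nonempty ∧ #A ≤ 2 * #B, z ^ #B
      ≤ ∑ A : Finset (Fin n), ∑ B : Finset (Fin n) with B.Nonempty, x ^ #A * y ^ #B := by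
        refine sum_le_sum fun A _ => ?_
        refine (sum_le_sum fun B hB => h1 A B (mem_filter.1 hB).2.2).trans ?_
        refine sum_le_sum_of_subset_of_nonneg ?_ fun _ _ _ => by positivity
        exact monotone_filter_right _ fun B _ hB => hB.1
    _ = (∑ A : Finset (Fin n), x ^ #A) * ∑ B : Finset (Fin n) with B.Nonempty, y ^ #B := by
        rw [sum_mul_sum]
    _ ≤ 3 * (2 * x ^ 7) := by
        gcongr
    _ = 6 * x ^ 7 := by ring

lemma log_sub_log_le_sum_inv {r h : ℕ} (hr : 1 ≤ r) (hrh : r ≤ h) :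
    Real.log h - Real.log r ≤ ∑ b ∈ Ico r h, (1 : ℝ) / b := by
  induction h, hrh using Nat.le_induction with
  | base => simp
  | succ h hrh ih =>
    rw [sum_Ico_succ_top hrh]
    have h0 : (0 : ℝ) < h := by
      have : 0 < h := by omega
      exact_mod_cast this
    have h1 := Real.log_le_sub_one_of_pos (show (0 : ℝ) < (h + 1 : ℕ) / h by positivity)
    rw [Real.log_div (by positivity) h0.ne'] at h1
    have h2 : ((h + 1 : ℕ) : ℝ) / h - 1 = 1 / h := by push_cast; field_simp; ring
    linarith

/-- The bipartite graph between `[r, n / 2)` and `[n / 2, n)` with edge set prescribed by `ω`. -/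
def halfGraph {n : ℕ} (r : ℕ) (ω : Finset (Fin n × Fin n)) : SimpleGraph (Fin n) where
  Adj u v := (r ≤ u.1 ∧ u.1 < n / 2 ∧ n / 2 ≤ v.1 ∧ (u, v) ∈ ω) ∨
    (r ≤ v.1 ∧ v.1 < n / 2 ∧ n / 2 ≤ u.1 ∧ (v, u) ∈ ω)
  symm := ⟨fun u v h => h.symm⟩
  loopless := ⟨fun v h => by omega⟩

lemma halfGraph_exists_dense {n r : ℕ} (hr : 1 ≤ r) {ω : Finset (Fin n × Fin n)}
    (h : (halfGraph r ω).HasRegularSubgraph r) : ∃ A B : Finset (Fin n), B.Nonempty ∧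
      #A ≤ 2 * #B ∧ (∀ b ∈ B, r ≤ b.1 ∧ #A ≤ 2 * b.1) ∧
      ∀ b ∈ B, r ≤ #{a ∈ A | (b, a) ∈ ω} := by
  obtain ⟨H, hH, hdeg, u₀, v₀, h₀⟩ := h.exists_le hr
  have hpos : ∀ v, H.degree v = r ↔ ∃ u, H.Adj v u := by
    intro v
    rw [← H.degree_pos_iff_exists_adj]
    rcases hdeg v with h | h <;> omega
  set A : Finset (Fin n) := {v | n / 2 ≤ v.1 ∧ H.degree v = r} with hA
  set B : Finset (Fin n) := {v | v.1 < n / 2 ∧ H.degree v = r} with hB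
  have hbip : H.IsBipartiteWith (A : Set (Fin n)) (B : Set (Fin n)) := by
    refine ⟨?_, ?_⟩
    · rw [disjoint_coe, disjoint_left]
      intro v hv hv'
      simp only [hA, hB, mem_filter] at hv hv'
      omega
    · intro u v huv
      have h1 := (hpos u).2 ⟨v, huv⟩
      have h2 := (hpos v).2 ⟨u, huv.symm⟩
      simp only [hA, hB, coe_filter, mem_univ, true_and, Set.mem_ofPred_eq, h1, h2, and_true]
      rcases hH huv with h | h <;> omega
  have hcard : #A = #B := by
    have h1 := SimpleGraph.isBipartiteWith_sum_degrees_eq hbip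
    rw [sum_congr rfl (g := fun _ => r) (by intro v hv; exact (mem_filter.1 hv).2.2),
      sum_congr (s₁ := B) rfl (g := fun _ => r) (by intro v hv; exact (mem_filter.1 hv).2.2),
      sum_const, sum_const, smul_eq_mul, smul_eq_mul] at h1
    exact Nat.eq_of_mul_eq_mul_right hr h1
  have hrB : ∀ b ∈ B, r ≤ b.1 := by
    intro b hb
    simp only [hB, mem_filter, mem_univ, true_and] at hb
    obtain ⟨u, hu⟩ := (hpos b).1 hb.2
    rcases hH hu with h | h <;> omega
  have hApos : 0 < #A := by
    have h1 : u₀ ∈ A ∪ B := by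
      have h2 := (hpos u₀).2 ⟨v₀, h₀⟩
      simp only [hA, hB, mem_union, mem_filter, mem_univ, true_and]
      omega
    have := card_pos.2 ⟨u₀, h1⟩
    have := card_union_le A B
    omega
  -- The vertices of B are distinct positive integers, so fewer than |A|/2 of them lie below |A|/2.
  have hlow : 2 * #{b ∈ B | ¬ #A ≤ 2 * b.1} ≤ #A := by
    have h1 : #{b ∈ B | ¬ #A ≤ 2 * b.1} ≤ #(Ico 1 ((#A + 1) / 2)) := by
      refine card_le_card_of_injOn (fun b => b.1) ?_ (fun a _ b _ h => Fin.ext h)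
      intro b hb
      have hb' := mem_filter.1 (mem_coe.1 hb)
      have := hrB b hb'.1
      refine mem_coe.2 (mem_Ico.2 (?_ : 1 ≤ b.1 ∧ b.1 < (#A + 1) / 2))
      omega
    rw [Nat.card_Ico] at h1
    omega
  have hsplit := card_filter_add_card_filter_not (s := B) (fun b => #A ≤ 2 * b.1)
  have h2 : #A ≤ 2 * #{b ∈ B | #A ≤ 2 * b.1} := by omega
  refine ⟨A, {b ∈ B | #A ≤ 2 * b.1}, card_pos.1 (by omega), h2, fun b hb => ?_, fun b hb => ?_⟩
  · rw [mem_filter] at hb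
    exact ⟨hrB b hb.1, hb.2⟩
  · have hb' := (mem_filter.1 (mem_filter.1 hb).1).2
    rw [← hb'.2, ← SimpleGraph.card_neighborFinset_eq_degree]
    refine card_le_card fun a ha => ?_
    rw [SimpleGraph.mem_neighborFinset] at ha
    have h3 := (hpos a).2 ⟨b, ha.symm⟩
    rw [mem_filter, hA, mem_filter]
    rcases hH ha with h | h
    · exact ⟨⟨mem_univ _, h.2.2.1, h3⟩, h.2.2.2⟩
    · omega

/-- The number of edges of `halfGraph r ω`. -/
noncomputable def halfEdges {n : ℕ} (r : ℕ) (ω : Finset (Fin n × Fin n)) : ℝ :=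
  ∑ b : Fin n with r ≤ b.1 ∧ b.1 < n / 2, ∑ a : Fin n with n / 2 ≤ a.1,
    if {(b, a)} ⊆ ω then (1 : ℝ) else 0

lemma halfEdges_le_sum_degree {n : ℕ} (r : ℕ) (ω : Finset (Fin n × Fin n)) :
    halfEdges r ω ≤ ∑ v, ((halfGraph r ω).degree v : ℝ) := by
  refine le_trans (sum_le_sum fun b hb => ?_)
    (sum_le_sum_of_subset_of_nonneg (subset_univ _) fun _ _ _ => Nat.cast_nonneg _)
  rw [sum_boole, ← SimpleGraph.card_neighborFinset_eq_degree, Nat.cast_le, filter_filter]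
  refine card_le_card fun a ha => ?_
  rw [mem_filter, singleton_subset_iff] at ha
  rw [mem_filter] at hb
  rw [SimpleGraph.mem_neighborFinset]
  exact Or.inl ⟨hb.2.1, hb.2.2, ha.2.1, ha.2.2⟩

lemma halfEdges_le {n : ℕ} (r : ℕ) (ω : Finset (Fin n × Fin n)) :
    halfEdges r ω ≤ (n : ℝ) ^ 2 := by
  have h1 : ∀ b : Fin n, ∑ a : Fin n with n / 2 ≤ a.1,
      (if {(b, a)} ⊆ ω then (1 : ℝ) else 0) ≤ n := by
    intro b
    rw [sum_boole, Nat.cast_le]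
    exact (card_le_univ _).trans (by simp)
  refine (sum_le_card_nsmul _ _ _ fun b _ => h1 b).trans ?_
  rw [nsmul_eq_mul, sq]
  gcongr
  exact (card_le_univ _).trans (by simp)

lemma le_subsetExpect_halfEdges {n r : ℕ} (hr : 1 ≤ r) (hrn : 16 * r ≤ n) {ε : ℝ} (hε : 0 ≤ ε) :
    ε * n * r * Real.logb 2 ((n : ℝ) / r) / 8 ≤
      subsetExpect (fun x : Fin n × Fin n => ε * r / (max r x.1.1 : ℕ)) (halfEdges r) := by
  have hr0 : (0 : ℝ) < r := by exact_mod_cast hr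
  have hn0 : (0 : ℝ) < n := by
    have : 0 < n := by omega
    exact_mod_cast this
  unfold halfEdges
  rw [subsetExpect_sum]
  have h1 : ∀ b ∈ (univ : Finset (Fin n)).filter (fun b => r ≤ b.1 ∧ b.1 < n / 2),
      (n : ℝ) / 2 * (ε * r) * (1 / b.1) ≤
      subsetExpect (fun x : Fin n × Fin n => ε * r / (max r x.1.1 : ℕ))
        (fun ω => ∑ a : Fin n with n / 2 ≤ a.1, if {(b, a)} ⊆ ω then (1 : ℝ) else 0) := by
    intro b hb
    rw [mem_filter] at hb
    rw [subsetExpect_sum]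
    rw [sum_congr rfl (g := fun _ => ε * r / (max r b.1 : ℕ)) (by
      intro a _
      convert subsetExpect_subset (fun x : Fin n × Fin n => ε * r / (max r x.1.1 : ℕ)) {(b, a)}
      rw [prod_singleton]), sum_const, nsmul_eq_mul]
    have h2 : max r b.1 = b.1 := max_eq_right hb.2.1
    have h3 : (n : ℝ) / 2 ≤ (#{a : Fin n | n / 2 ≤ a.1} : ℝ) := by
      have h4 := card_filter_add_card_filter_not (s := (univ : Finset (Fin n)))
        (fun a => n / 2 ≤ a.1)
      have h5 : #{a : Fin n | ¬ n / 2 ≤ a.1} = n / 2 := by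
        simp only [not_le]
        rw [Fin.card_filter_val_lt]; omega
      rw [card_univ, Fintype.card_fin, h5] at h4
      have h6 : n ≤ 2 * #{a : Fin n | n / 2 ≤ a.1} := by omega
      have h7 : (n : ℝ) ≤ 2 * (#{a : Fin n | n / 2 ≤ a.1} : ℝ) := by exact_mod_cast h6
      linarith
    rw [h2, mul_assoc, mul_one_div]
    gcongr
  refine le_trans ?_ (sum_le_sum h1)
  rw [← mul_sum]
  have h2 : ∑ b : Fin n with r ≤ b.1 ∧ b.1 < n / 2, (1 : ℝ) / b.1 =
      ∑ b ∈ Ico r (n / 2), (1 : ℝ) / b := by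
    rw [sum_filter, Fin.sum_univ_eq_sum_range
      (fun b => if r ≤ b ∧ b < n / 2 then (1 : ℝ) / b else 0), ← sum_filter]
    refine sum_congr ?_ fun _ _ => rfl
    ext b
    simp only [mem_filter, mem_range, mem_Ico]
    omega
  rw [h2]
  have h3 := log_sub_log_le_sum_inv hr (show r ≤ n / 2 by omega)
  -- With x = n/r ≥ 16, flooring n/2 still leaves a ratio of at least x/3, and (x/3)² ≥ x.
  have h4 : Real.logb 2 ((n : ℝ) / r) / 4 ≤ Real.log (n / 2 : ℕ) - Real.log r := by
    have h5 : (n : ℝ) / 3 ≤ ((n / 2 : ℕ) : ℝ) := by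
      have : n ≤ 3 * (n / 2) := by omega
      have : (n : ℝ) ≤ 3 * ((n / 2 : ℕ) : ℝ) := by exact_mod_cast this
      linarith
    have h6 : (0 : ℝ) < ((n / 2 : ℕ) : ℝ) := lt_of_lt_of_le (by positivity) h5
    have hx16 : (16 : ℝ) ≤ n / r := by
      rw [le_div_iff₀ hr0]; exact_mod_cast hrn
    have h7 : (n : ℝ) / r ≤ (((n / 2 : ℕ) : ℝ) / r) ^ 2 := by
      have h8 : (n : ℝ) / r / 3 ≤ ((n / 2 : ℕ) : ℝ) / r := by
        rw [div_right_comm]; gcongr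
      nlinarith
    have h9 := Real.log_le_log (by positivity) h7
    rw [Real.log_pow, Real.log_div h6.ne' hr0.ne'] at h9
    have h10 : Real.logb 2 ((n : ℝ) / r) ≤ 2 * Real.log ((n : ℝ) / r) := by
      have h11 : 0 ≤ Real.log ((n : ℝ) / r) := Real.log_nonneg (by linarith)
      rw [Real.logb, div_le_iff₀ (Real.log_pos (by norm_num))]
      nlinarith [Real.log_two_gt_d9]
    push_cast at h9 ⊢
    linarith
  calc ε * n * r * Real.logb 2 ((n : ℝ) / r) / 8 =
      (n : ℝ) / 2 * (ε * r) * (Real.logb 2 ((n : ℝ) / r) / 4) := by ring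
    _ ≤ _ := by gcongr; linarith

lemma exists_not_hasRegularSubgraph_random {r n : ℕ} (hr : 2 ≤ r) (hnr : n ≤ 4 ^ r)
    (hrn : 16 * r ≤ n) : ∃ G : SimpleGraph (Fin n),
      1 / 2 ^ 27 * (r : ℝ) * Real.logb 2 ((n : ℝ) / r) ≤ G.avgDegree ∧
        ¬ G.HasRegularSubgraph r := by
  have hr0 : (0 : ℝ) < r := by
    have : 0 < r := by omega
    exact_mod_cast this
  have hn32 : (32 : ℝ) ≤ n := by
    have : 32 ≤ n := by omega
    exact_mod_cast this
  have hn0 : (0 : ℝ) < n := by linarith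
  -- Chosen so that 8ε = 4^(-10), whence (8ε)^r ≤ n^(-10) when n ≤ 4^r.
  set ε : ℝ := 1 / 2 ^ 23 with hε
  have hε0 : 0 < ε := by positivity
  set q : Fin n → ℝ := fun b => ε * r / (max r b.1 : ℕ) with hq
  have hq0 : ∀ b, 0 ≤ q b := fun b => by positivity
  have hq1 : ∀ b, q b ≤ 1 := by
    intro b
    simp only [hq]
    rw [div_le_one (lt_of_lt_of_le hr0 (Nat.cast_le.2 (le_max_left _ _)))]
    calc ε * r ≤ 1 * r := by gcongr; rw [hε]; norm_num
      _ ≤ _ := by rw [one_mul]; exact Nat.cast_le.2 (le_max_left _ _)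
  set P : Finset (Fin n) → Finset (Fin n) → Prop := fun A B =>
    (B.Nonempty ∧ #A ≤ 2 * #B) ∧ ∀ b ∈ B, r ≤ b.1 ∧ #A ≤ 2 * b.1 with hP
  set X : Finset (Fin n × Fin n) → ℝ := fun ω =>
    ∑ A : Finset (Fin n), ∑ B : Finset (Fin n) with P A B, denseRows r A B ω with hX
  set z : ℝ := (8 * ε) ^ r with hz
  have hz10 : z ≤ (1 / n : ℝ) ^ 10 := by
    have h1 : 8 * ε = (1 / 4) ^ 10 := by rw [hε]; norm_num
    have h2 : (n : ℝ) ≤ 4 ^ r := by exact_mod_cast hnr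
    rw [hz, h1, ← pow_mul, mul_comm, pow_mul, div_pow, one_pow]
    gcongr
  have hXE : subsetExpect (fun x : Fin n × Fin n => q x.1) X ≤ 6 * (1 / n : ℝ) ^ 7 := by
    refine le_trans ?_ (sum_pow_card_le (n := n) (by omega) (by positivity) hz10)
    rw [hX, subsetExpect_sum]
    refine sum_le_sum fun A _ => ?_
    rw [subsetExpect_sum]
    refine le_trans (sum_le_sum (g := fun B => z ^ #B) fun B hB => ?_)
      (sum_le_sum_of_subset_of_nonneg ?_ fun _ _ _ => by positivity)
    · have hB' := (mem_filter.1 hB).2.2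
      refine (subsetExpect_denseRows r A B q).trans_le ?_
      rw [← prod_const]
      refine prod_le_prod (fun b _ => mul_nonneg (Nat.cast_nonneg _) (pow_nonneg (hq0 b) _))
        fun b hb => ?_
      have h1 : max r b.1 = b.1 := max_eq_right (hB' b hb).1
      simp only [hq, h1]
      exact choose_mul_pow_le (by omega) (hB' b hb).1 (hB' b hb).2 hε0.le
    · exact monotone_filter_right _ fun B _ hB => hB.1
  set l := Real.logb 2 ((n : ℝ) / r) with hl
  have hl1 : 1 ≤ l := by
    rw [hl, Real.le_logb_iff_rpow_le (by norm_num) (by positivity), Real.rpow_one,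
      le_div_iff₀ hr0]
    have : 2 * r ≤ n := by omega
    exact_mod_cast this
  have hE := le_subsetExpect_halfEdges (n := n) (r := r) (by omega) hrn hε0.le
  -- The penalty n² exceeds or equals any possible edge count, so an outcome with positive value has
  -- X < 1: it has many edges and no dense pair (A, B) at once.
  have hE' : ε * n * r * l / 16 ≤ subsetExpect (fun x : Fin n × Fin n => q x.1)
      (fun ω => halfEdges r ω - (n : ℝ) ^ 2 * X ω) := by
    rw [subsetExpect_sub, subsetExpect_mul_left]
    have h1 : (n : ℝ) ^ 2 * subsetExpect (fun x : Fin n × Fin n => q x.1) X ≤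
        ε * n * r * l / 16 := by
      calc (n : ℝ) ^ 2 * subsetExpect (fun x : Fin n × Fin n => q x.1) X ≤
          (n : ℝ) ^ 2 * (6 * (1 / n : ℝ) ^ 7) := by gcongr
        _ = 6 / (n : ℝ) ^ 5 := by field_simp
        _ ≤ 6 / 32 ^ 5 := by gcongr
        _ ≤ ε * 32 * 1 * 1 / 16 := by rw [hε]; norm_num
        _ ≤ ε * n * r * l / 16 := by
            gcongr
            have : 1 ≤ r := by omega
            exact_mod_cast this
    have h2 : subsetExpect (fun x : Fin n × Fin n => q x.1) (halfEdges r) =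
      subsetExpect (fun x : Fin n × Fin n => ε * r / (max r x.1.1 : ℕ)) (halfEdges r) := rfl
    linarith
  obtain ⟨ω, hω⟩ : ∃ ω, ε * n * r * l / 16 ≤ halfEdges r ω - (n : ℝ) ^ 2 * X ω :=
    exists_le_of_le_subsetExpect (p := fun x : Fin n × Fin n => q x.1)
      (f := fun ω => halfEdges r ω - (n : ℝ) ^ 2 * X ω) (fun x => hq0 x.1) (fun x => hq1 x.1) hE'
  have hl0 : 0 < l := by linarith
  have hpos : 0 < ε * n * r * l / 16 :=
    div_pos (mul_pos (mul_pos (mul_pos hε0 hn0) hr0) hl0) (by norm_num)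
  have hX0 : ∀ A, 0 ≤ ∑ B : Finset (Fin n) with P A B, denseRows r A B ω :=
    fun A => sum_nonneg fun B _ => denseRows_nonneg A B ω
  refine ⟨halfGraph r ω, ?_, fun h => ?_⟩
  · have h1 : (halfGraph r ω).avgDegree = (∑ v, ((halfGraph r ω).degree v : ℝ)) / n := by
      simp [SimpleGraph.avgDegree]
    have h2 := halfEdges_le_sum_degree r ω
    have h3 : 0 ≤ (n : ℝ) ^ 2 * X ω := mul_nonneg (by positivity) (sum_nonneg fun A _ => hX0 A)
    rw [h1, le_div_iff₀ hn0]
    have h4 : 1 / 2 ^ 27 * (r : ℝ) * l * n = ε * n * r * l / 16 := by rw [hε]; ring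
    linarith
  · obtain ⟨A, B, hB, hAB, hb, hd⟩ := halfGraph_exists_dense (by omega) h
    have h1 : 1 ≤ X ω := by
      refine (one_le_denseRows hd).trans ?_
      refine le_trans ?_ (single_le_sum (f := fun A => ∑ B : Finset (Fin n) with P A B,
        denseRows r A B ω) (fun A _ => hX0 A) (mem_univ A))
      exact single_le_sum (f := fun B => denseRows r A B ω) (fun B _ => denseRows_nonneg A B ω)
        (mem_filter.2 ⟨mem_univ B, ⟨hB, hAB⟩, hb⟩)
    have h2 := halfEdges_le r ω
    have h3 := le_mul_of_one_le_right (sq_nonneg (n : ℝ)) h1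
    linarith

theorem exists_not_hasRegularSubgraph : ∃ c : ℝ, 0 < c ∧ ∀ r n : ℕ, 2 ≤ r →
    Real.logb 2 (n : ℝ) / 2 ≤ (r : ℝ) → (r : ℝ) ≤ (n : ℝ) / 2 → ∃ G : SimpleGraph (Fin n),
      c * (r : ℝ) * Real.logb 2 ((n : ℝ) / (r : ℝ)) ≤ G.avgDegree ∧
        ¬ G.HasRegularSubgraph r := by
  refine ⟨1 / 2 ^ 27, by positivity, ?_⟩
  intro r n hr hlog hrn
  have hr0 : (0 : ℝ) < r := by
    have : 0 < r := by omega
    exact_mod_cast this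
  have hrn' : 2 * r ≤ n := by
    have : (2 : ℝ) * r ≤ n := by linarith
    exact_mod_cast this
  have hn0 : (0 : ℝ) < n := by linarith
  rcases le_or_gt (16 * r) n with h | h
  · refine exists_not_hasRegularSubgraph_random hr ?_ h
    have h1 : Real.logb 2 n ≤ 2 * r := by linarith
    rw [Real.logb_le_iff_le_rpow (by norm_num) hn0, Real.rpow_mul (by norm_num),
      Real.rpow_natCast] at h1
    norm_num at h1
    exact_mod_cast h1
  · obtain ⟨G, hG, hreg⟩ := exists_not_hasRegularSubgraph_complete hr hrn'
    refine ⟨G, le_trans ?_ hG, hreg⟩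
    have h1 : Real.logb 2 ((n : ℝ) / r) ≤ 4 := by
      rw [Real.logb_le_iff_le_rpow (by norm_num) (by positivity), div_le_iff₀ hr0]
      have : (n : ℝ) ≤ 16 * r := by exact_mod_cast h.le
      norm_num
      exact this
    calc 1 / 2 ^ 27 * (r : ℝ) * Real.logb 2 ((n : ℝ) / r) ≤ 1 / 2 ^ 27 * (r : ℝ) * 4 := by gcongr
      _ ≤ (r : ℝ) / 4 := by linarith

end LowerBound

theorem theorem1p5 :
    (∃ C : ℝ, 0 < C ∧ ∀ r n : ℕ, 1 ≤ r → (r : ℝ) ≤ (n : ℝ) / 2 →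
      ∀ G : SimpleGraph (Fin n),
        C * (r : ℝ) * Real.logb 2 ((n : ℝ) / (r : ℝ)) ≤ G.avgDegree →
          G.HasRegularSubgraph r) ∧
    (∃ c : ℝ, 0 < c ∧ ∀ r n : ℕ, 2 ≤ r → Real.logb 2 (n : ℝ) / 2 ≤ (r : ℝ) →
      (r : ℝ) ≤ (n : ℝ) / 2 →
        ∃ G : SimpleGraph (Fin n),
          c * (r : ℝ) * Real.logb 2 ((n : ℝ) / (r : ℝ)) ≤ G.avgDegree ∧
            ¬ G.HasRegularSubgraph r) :=
  ⟨exists_hasRegularSubgraph_of_avgDegree, exists_not_hasRegularSubgraph⟩
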